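/- Let $m_1,m_2\ge 1$ be real, $\rho(z)=|z_1|^{2m_1}+|z_2|^{2m_2}$ and $\mathcal E=\{z\in\mathbb C^2:\rho(z)<1\}$. Let $dS$ be the positive measure on $\partial\mathcal E$ defined by the form $\partial\rho\wedge\bar\partial\partial\rho$ (i.e. the absolute value of its restriction to $\partial\mathcal E$). For $f\in L^1(\partial\mathcal E,dS)$ and $z\in\mathcal E$ let $$Kf(z)=\frac1{(2\pi i)^2}\int_{\partial\mathcal E}\frac{f(\xi)\,dS(\xi)}{w(\xi,z)^2},\qquad w(\xi,z)=\sum_{j=1}^2 m_j|\xi_j|^{2(m_j-1)}\bar\xi_j(\xi_j-z_j),$$ and on $\partial\mathcal E$ let $Kf(z)=\lim_{r\to1-}Kf(rz)$ where this limit exists $dS$-almost everywhere. For measurable $p:\partial\mathcal E\to(1,\infty)$ let $L^{p(\cdot)}(\partial\mathcal E)$ be the space of all $f\in L^1(\partial\mathcal E,dS)$ with $\int_{\partial\mathcal E}|tf|^{p}\,dS<\infty$ for some $t>0$, with the Luxemburg norm $\|f\|=\inf\{t>0:\int_{\partial\mathcal E}|f/t|^{p}\,dS\le1\}$. Write $\xi_j=r_je^{i\theta_j}$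 with $\theta_j\in(-\pi,\pi]$ (and $\theta_j=0$ if $\xi_j=0$). For $\alpha>0$ and $0<\gamma_1<\gamma_2$ put $$W_\alpha=\Big\{\xi\in\partial\mathcal E:\ -\tfrac{\pi}{12}\le\theta_1\le0,\ -2\alpha\le\theta_2\le-\alpha,\ \gamma_1\alpha\le r_1^{2m_1}\le\gamma_2\alpha\Big\}.$$ **Theorem.** There are $0<\gamma_1<\gamma_2$ such that the following holds for every $p_0>1$ and every continuous $\psi:[-\pi,\pi]\to(1-p_0,\infty)$ such that $\psi(0)=0$, $\lim_{\alpha\to0+}\psi(\alpha)\ln\frac1\alpha=+\infty$ and, for some $\delta\in(0,\pi]$, $\psi$ is nondecreasing on $[0,\delta]$ and negative on $[-\delta,0)$. Put $p(\xi)=p_0+\psi(\theta_2)$. 1. There is $\alpha_0>0$ such that there are sequences $(\alpha_k)_{k\ge1}$ in $(0,\alpha_0)$ with $$2\alpha_{k+1}\le\alpha_k,\qquad \Big(\frac1{\alpha_k}\Big)^{\frac1{p_0+\psi(\alpha_k)}-\frac1{p_0}}\le2^{-k/p_0}\qquad(k\ge1),$$ and for every such sequence the function $h=\sum_{k\ge1}\lambda_k\chi_{W_{\alpha_k}}$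 with $\lambda_k=\alpha_k^{-2/(p_0+\psi(\alpha_k))}$ belongs to $L^{p(\cdot)}(\partial\mathcal E)$, while its image $Kh$ exists $dS$-almost everywhere on $\partial\mathcal E$ and does not belong to $L^{p(\cdot)}(\partial\mathcal E)$; in fact $\int_{\partial\mathcal E}|tKh|^{p}\,dS=\infty$ for every $t>0$. 2. $K$ is not bounded on $L^{p(\cdot)}(\partial\mathcal E)$: there is no constant $C$ such that, for every $f\in L^{p(\cdot)}(\partial\mathcal E)$ for which $Kf$ exists $dS$-almost everywhere on $\partial\mathcal E$, one has $Kf\in L^{p(\cdot)}(\partial\mathcal E)$ and $\|Kf\|\le C\|f\|$. 3. Call a function $u$ on a set $X$ with distance $d$ log-Hölder near $x\in X$ if there are $C$ and a neighbourhood $U$ of $x$ in $X$ with $|u(y)-u(y')|\le C/|\log d(y,y')|$ for all distinct $y,y'\in U$ (use the Euclidean distance on $\partial\mathcal E$ and on $[-\pi,\pi]$). Then $p$ is not log-Hölder near any $\xi\in\partial\mathcal E$ with $\xi_2\ne0$ and $\theta_2=0$. If moreover $\psi(-\pi)=\psi(\pi)$ and $\psi$ is log-Hölder near every point of $[-\pi,\pi]\setminus\{0\}$,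 then $p$ is log-Hölder near every $\xi\in\partial\mathcal E$ with $\xi_2\neq0$ and $\theta_2\neq0$. -/

import Mathlib

open Real Set Filter Topology MeasureTheory

noncomputable section

namespace CLF

/-- The boundary of the complex ellipsoid `|z₁|^(2m₁) + |z₂|^(2m₂) < 1` in `ℂ²`. -/
def bdry (m₁ m₂ : ℝ) : Set (ℂ × ℂ) :=
  {ξ | ‖ξ.1‖ ^ (2 * m₁) + ‖ξ.2‖ ^ (2 * m₂) = 1}

/-- The `(1,0)`-form `∂ρ` at `ξ`, `ρ(ξ) = |ξ₁|^(2m₁) + |ξ₂|^(2m₂)`, evaluated at the vector `X`. -/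
def dRho (m₁ m₂ : ℝ) (ξ X : ℂ × ℂ) : ℂ :=
  ((m₁ * ‖ξ.1‖ ^ (2 * (m₁ - 1)) : ℝ) : ℂ) * star ξ.1 * X.1
    + ((m₂ * ‖ξ.2‖ ^ (2 * (m₂ - 1)) : ℝ) : ℂ) * star ξ.2 * X.2

/-- The 2-form `∂̄∂ρ = ∑ⱼ mⱼ² |ξⱼ|^(2(mⱼ-1)) dξ̄ⱼ ∧ dξⱼ` at `ξ`, evaluated at `X, Y`. -/
def ddRho (m₁ m₂ : ℝ) (ξ X Y : ℂ × ℂ) : ℂ :=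
  ((m₁ ^ 2 * ‖ξ.1‖ ^ (2 * (m₁ - 1)) : ℝ) : ℂ) * (star X.1 * Y.1 - star Y.1 * X.1)
    + ((m₂ ^ 2 * ‖ξ.2‖ ^ (2 * (m₂ - 1)) : ℝ) : ℂ) * (star X.2 * Y.2 - star Y.2 * X.2)

/-- The 3-form `∂ρ ∧ ∂̄∂ρ` at `ξ`, evaluated at `X, Y, Z`. -/
def lerayForm (m₁ m₂ : ℝ) (ξ X Y Z : ℂ × ℂ) : ℂ :=
  dRho m₁ m₂ ξ X * ddRho m₁ m₂ ξ Y Z - dRho m₁ m₂ ξ Y * ddRho m₁ m₂ ξ X Z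
    + dRho m₁ m₂ ξ Z * ddRho m₁ m₂ ξ X Y

/-- Polar parametrization `(r₁, θ₁, θ₂) ↦ (r₁ e^{iθ₁}, r₂(r₁) e^{iθ₂})` of the boundary,
where `r₂(r₁) = (1 - r₁^(2m₁))^(1/(2m₂))`. -/
def param (m₁ m₂ : ℝ) (t : ℝ × ℝ × ℝ) : ℂ × ℂ :=
  ((t.1 : ℂ) * Complex.exp (t.2.1 * Complex.I),
    (((1 - t.1 ^ (2 * m₁)) ^ (1 / (2 * m₂)) : ℝ) : ℂ) * Complex.exp (t.2.2 * Complex.I))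

/-- Parameter domain; on it `param` is a bijection onto the boundary without
the two circles `ξ₁ = 0` and `ξ₂ = 0`. -/
def paramDomain : Set (ℝ × ℝ × ℝ) :=
  Ioo (0 : ℝ) 1 ×ˢ Ioc (-π) π ×ˢ Ioc (-π) π

/-- Density of the pull-back of `∂ρ ∧ ∂̄∂ρ` to the parameter domain. -/
def lerayDensity (m₁ m₂ : ℝ) (t : ℝ × ℝ × ℝ) : ℝ :=
  ‖lerayForm m₁ m₂ (param m₁ m₂ t)
    (deriv (fun r : ℝ => param m₁ m₂ (r, t.2.1, t.2.2)) t.1)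
    (deriv (fun θ : ℝ => param m₁ m₂ (t.1, θ, t.2.2)) t.2.1)
    (deriv (fun θ : ℝ => param m₁ m₂ (t.1, t.2.1, θ)) t.2.2)‖

/-- The positive measure `dS` on the boundary defined by the form `∂ρ ∧ ∂̄∂ρ`. -/
def lerayMeasure (m₁ m₂ : ℝ) : Measure (ℂ × ℂ) :=
  Measure.map (param m₁ m₂)
    ((volume.restrict paramDomain).withDensity
      (fun t => ENNReal.ofReal (lerayDensity m₁ m₂ t)))

/-- `w(ξ,z) = ⟨∂ρ(ξ), ξ - z⟩`. -/
def w (m₁ m₂ : ℝ) (ξ z : ℂ × ℂ) : ℂ := dRho m₁ m₂ ξ (ξ - z)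

/-- The Cauchy–Leray–Fantappiè integral of `f` at an interior point `z`. -/
def cauchyLF (m₁ m₂ : ℝ) (f : ℂ × ℂ → ℂ) (z : ℂ × ℂ) : ℂ :=
  1 / (2 * (π : ℂ) * Complex.I) ^ 2 * ∫ ξ, f ξ / (w m₁ m₂ ξ z) ^ 2 ∂(lerayMeasure m₁ m₂)

/-- `g = Kf` on the boundary: the interior function `Kf` has radial limit `g` at almost
every boundary point. -/
def IsImage (m₁ m₂ : ℝ) (f g : ℂ × ℂ → ℂ) : Prop :=
  ∀ᵐ z ∂(lerayMeasure m₁ m₂),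
    Tendsto (fun r : ℝ => cauchyLF m₁ m₂ f (r • z)) (𝓝[<] 1) (𝓝 (g z))

/-- The modular `∫ |f|^{p(ξ)} dS`. -/
def modular (m₁ m₂ : ℝ) (p : ℂ × ℂ → ℝ) (f : ℂ × ℂ → ℂ) : ENNReal :=
  ∫⁻ ξ, ENNReal.ofReal (‖f ξ‖ ^ p ξ) ∂(lerayMeasure m₁ m₂)

/-- `f ∈ L^{p(·)}`. -/
def MemLpVar (m₁ m₂ : ℝ) (p : ℂ × ℂ → ℝ) (f : ℂ × ℂ → ℂ) : Prop :=
  Integrable f (lerayMeasure m₁ m₂) ∧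
    ∃ t : ℝ, 0 < t ∧ modular m₁ m₂ p (fun ξ => (t : ℂ) * f ξ) < ⊤

/-- The Luxemburg norm. -/
def luxNorm (m₁ m₂ : ℝ) (p : ℂ × ℂ → ℝ) (f : ℂ × ℂ → ℂ) : ℝ :=
  sInf {t : ℝ | 0 < t ∧ modular m₁ m₂ p (fun ξ => f ξ / (t : ℂ)) ≤ 1}

/-- `K` is bounded on `L^{p(·)}`: every image `g = Kf` of `f ∈ L^{p(·)}` lies in `L^{p(·)}`,
with `‖Kf‖ ≤ C ‖f‖`. -/
def BoundedOnLpVar (m₁ m₂ : ℝ) (p : ℂ × ℂ → ℝ) : Prop :=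
  ∃ C : ℝ, ∀ f g : ℂ × ℂ → ℂ, MemLpVar m₁ m₂ p f → IsImage m₁ m₂ f g →
    MemLpVar m₁ m₂ p g ∧ luxNorm m₁ m₂ p g ≤ C * luxNorm m₁ m₂ p f

/-- Euclidean distance in `ℂ²` (the norm of the product type is the maximum norm). -/
def edist₂ (z z' : ℂ × ℂ) : ℝ := √(‖z.1 - z'.1‖ ^ 2 + ‖z.2 - z'.2‖ ^ 2)

/-- The log-Hölder condition for `p` on the boundary, near the boundary point `ξ`. -/
def LogHolderNear (m₁ m₂ : ℝ) (p : ℂ × ℂ → ℝ) (ξ : ℂ × ℂ) : Prop :=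
  ∃ C δ : ℝ, 0 < δ ∧ ∀ z ∈ bdry m₁ m₂, ∀ z' ∈ bdry m₁ m₂,
    edist₂ z ξ < δ → edist₂ z' ξ < δ → |p z - p z'| ≤ C / |Real.log (edist₂ z z')|

/-- The log-Hölder condition for `ψ` on `[-π, π]`, near `s`. -/
def LogHolderNearReal (ψ : ℝ → ℝ) (s : ℝ) : Prop :=
  ∃ C δ : ℝ, 0 < δ ∧ ∀ t ∈ Icc (-π) π, ∀ t' ∈ Icc (-π) π,
    |t - s| < δ → |t' - s| < δ → |ψ t - ψ t'| ≤ C / abs (Real.log (abs (t - t')))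

/-- The exponent `p(ξ) = p₀ + ψ(θ₂)`, where `θ₂ ∈ (-π, π]` is the argument of `ξ₂`. -/
def exponent (p₀ : ℝ) (ψ : ℝ → ℝ) (ξ : ℂ × ℂ) : ℝ := p₀ + ψ (Complex.arg ξ.2)

/-- The assumptions on `p₀` and `ψ : [-π, π] → (1 - p₀, ∞)`. -/
structure Profile (p₀ : ℝ) (ψ : ℝ → ℝ) : Prop where
  one_lt : 1 < p₀
  cont : ContinuousOn ψ (Icc (-π) π)
  lower : ∀ t ∈ Icc (-π) π, 1 - p₀ < ψ t
  zero : ψ 0 = 0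
  near : ∃ δ : ℝ, 0 < δ ∧ δ ≤ π ∧ MonotoneOn ψ (Icc 0 δ) ∧ ∀ t ∈ Ico (-δ) 0, ψ t < 0
  lim : Tendsto (fun t : ℝ => ψ t * Real.log (1 / t)) (𝓝[>] 0) atTop

/-- The boundary patch `W_α`. -/
def patch (m₁ m₂ γ₁ γ₂ α : ℝ) : Set (ℂ × ℂ) :=
  {ξ | ξ ∈ bdry m₁ m₂ ∧ Complex.arg ξ.1 ∈ Icc (-(π / 12)) 0 ∧
    Complex.arg ξ.2 ∈ Icc (-2 * α) (-α) ∧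
    γ₁ * α ≤ ‖ξ.1‖ ^ (2 * m₁) ∧ ‖ξ.1‖ ^ (2 * m₁) ≤ γ₂ * α}

/-- Admissible sequences `α₁, α₂, …` in `(0, α₀)`; here `a k` stands for `α_{k+1}`. -/
structure Admissible (p₀ : ℝ) (ψ : ℝ → ℝ) (α₀ : ℝ) (a : ℕ → ℝ) : Prop where
  pos : ∀ k, 0 < a k
  lt : ∀ k, a k < α₀
  halving : ∀ k, 2 * a (k + 1) ≤ a k
  decay : ∀ k : ℕ, (1 / a k) ^ (1 / (p₀ + ψ (a k)) - 1 / p₀) ≤ (2 : ℝ) ^ (-((k : ℝ) + 1) / p₀)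

/-- `λ = α ^ (-2 / (p₀ + ψ(α)))`. -/
def coeff (p₀ : ℝ) (ψ : ℝ → ℝ) (α : ℝ) : ℝ := α ^ (-2 / (p₀ + ψ α))

/-- `h = ∑ₖ λₖ χ_{W_{αₖ}}`. -/
def testFun (m₁ m₂ γ₁ γ₂ p₀ : ℝ) (ψ : ℝ → ℝ) (a : ℕ → ℝ) (ξ : ℂ × ℂ) : ℂ :=
  ∑' k : ℕ, (patch m₁ m₂ γ₁ γ₂ (a k)).indicator (fun _ => (coeff p₀ ψ (a k) : ℂ)) ξ

end CLF

end

/-!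
On the patch `W_α` the exponent is at most `p₀`, so `∫ |h|^p` over the patch is about `λ_α ^ p₀ α²`,
which the decay condition on the sequence makes summable. For `z` in the reflected patch, where
`α < θ₂ < 2α`, the kernel `w(ξ, z)⁻²` has negative real part for `ξ` in any patch of the sequence,
so nothing cancels, and on `W_α` it is about `-α⁻²`; hence `|Kh|` is at least a constant times `λ_α`
there. Since `λ_α ^ (p₀ + ψ α) α² = 1`, each reflected patch contributes at least a fixed amount to
the modular of `Kh`, and the modular diverges. The factor `α²` is the measure of the patch: in the
coordinates `(r₁ ^ (2 m₁), θ₁, θ₂)` the measure `dS` is a multiple of Lebesgue measure.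

The radial limit of `Kh` exists at every point near which `h` is constant: `K` maps constants to
constants, by the mean value property in the angles, so the constant can be subtracted, and the
kernel is bounded on the rest.
-/

noncomputable section

namespace CLF

section Coordinate

variable {m : ℝ}

lemma rpow_two_mul_sub_one_mul_sq {a : ℝ} (hm : m ≠ 0) (ha : 0 ≤ a) :
    a ^ (2 * (m - 1)) * a ^ 2 = a ^ (2 * m) := by
  rcases ha.eq_or_lt with rfl | ha
  · simp [zero_rpow (mul_ne_zero two_ne_zero hm)]
  · rw [← rpow_natCast a 2, ← rpow_add ha]
    congr 1
    push_cast
    ring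

-- Bernoulli's inequality for `(b / a) ^ (2 * m)`, multiplied by `a ^ (2 * m)`.
lemma two_mul_rpow_mul_lt {a b : ℝ} (hm : 1 / 2 < m) (ha : 0 ≤ a) (hb : 0 ≤ b) (hab : a ≠ b) :
    2 * m * (a ^ (2 * (m - 1)) * a * b) < (2 * m - 1) * a ^ (2 * m) + b ^ (2 * m) := by
  rcases ha.eq_or_lt with rfl | ha
  · simpa [zero_rpow (by linarith : 2 * m ≠ 0)] using rpow_pos_of_pos (hb.lt_of_ne hab) (2 * m)
  · have bernoulli := one_add_mul_self_lt_rpow_one_add (s := b / a - 1) (p := 2 * m)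
      (by linarith [div_nonneg hb ha.le])
      (by rw [sub_ne_zero, ne_eq, div_eq_one_iff_eq ha.ne']; exact hab.symm) (by linarith)
    rw [add_sub_cancel, div_rpow hb ha.le, lt_div_iff₀ (rpow_pos_of_pos ha _)] at bernoulli
    have hdiv : b / a * a ^ (2 * m) = a ^ (2 * (m - 1)) * a * b := by
      rw [← rpow_two_mul_sub_one_mul_sq (by linarith) ha.le]
      field_simp
    linear_combination bernoulli - 2 * m * hdiv

lemma mul_rpow_mul_le {a b : ℝ} (hm : 1 / 2 < m) (ha : 0 ≤ a) (hb : 0 ≤ b) :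
    m * (a ^ (2 * (m - 1)) * a * b) ≤ m * a ^ (2 * m) - (a ^ (2 * m) - b ^ (2 * m)) / 2 := by
  rcases eq_or_ne a b with rfl | hab
  · rw [mul_assoc (a ^ _), ← sq, rpow_two_mul_sub_one_mul_sq (by linarith) ha]
    simp
  · linarith [two_mul_rpow_mul_lt hm ha hb hab]

/-- The contribution `m |ξ| ^ (2 (m - 1)) ξ̄ (ξ - z)` of one complex coordinate to `w`. -/
def wCoord (m : ℝ) (ξ z : ℂ) : ℂ := ((m * ‖ξ‖ ^ (2 * (m - 1)) : ℝ) : ℂ) * star ξ * (ξ - z)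

lemma w_eq_wCoord_add (m₁ m₂ : ℝ) (ξ z : ℂ × ℂ) :
    w m₁ m₂ ξ z = wCoord m₁ ξ.1 z.1 + wCoord m₂ ξ.2 z.2 := rfl

lemma wCoord_eq_sub (hm : m ≠ 0) (ξ z : ℂ) :
    wCoord m ξ z = ((m * ‖ξ‖ ^ (2 * m) : ℝ) : ℂ)
      - ((m * ‖ξ‖ ^ (2 * (m - 1)) : ℝ) : ℂ) * (star ξ * z) := by
  have hξ : star ξ * ξ = ((‖ξ‖ ^ 2 : ℝ) : ℂ) := by
    simpa using Complex.conj_mul' ξ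
  rw [wCoord, ← rpow_two_mul_sub_one_mul_sq hm (norm_nonneg ξ), mul_assoc, mul_sub, mul_sub, hξ]
  push_cast
  ring

lemma wCoord_re (hm : m ≠ 0) (ξ z : ℂ) :
    (wCoord m ξ z).re = m * ‖ξ‖ ^ (2 * m) - m * ‖ξ‖ ^ (2 * (m - 1)) * (star ξ * z).re := by
  rw [wCoord_eq_sub hm, Complex.sub_re, Complex.re_ofReal_mul, Complex.ofReal_re]

lemma wCoord_im (hm : m ≠ 0) (ξ z : ℂ) :
    (wCoord m ξ z).im = -(m * ‖ξ‖ ^ (2 * (m - 1)) * (star ξ * z).im) := by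
  rw [wCoord_eq_sub hm, Complex.sub_im, Complex.im_ofReal_mul, Complex.ofReal_im, zero_sub]

lemma star_mul_re_lt_sq_norm {ξ z : ℂ} (hnorm : ‖z‖ = ‖ξ‖) (hne : z ≠ ξ) :
    (star ξ * z).re < ‖ξ‖ ^ 2 := by
  have hξ : ‖ξ‖ ≠ 0 := fun h0 => hne <| by
    rw [norm_eq_zero.1 h0, norm_eq_zero.1 (hnorm.trans h0)]
  have hsmul : ‖z‖ • ξ ≠ ‖ξ‖ • z := by
    rw [hnorm]
    exact fun h => hne (smul_right_injective ℂ hξ h).symm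
  have hlt := inner_lt_norm_mul_iff_real.2 hsmul
  rwa [Complex.inner, hnorm, ← sq, mul_comm] at hlt

lemma lt_wCoord_re {ξ z : ℂ} (hm : 1 / 2 < m) (hne : z ≠ ξ) :
    (‖ξ‖ ^ (2 * m) - ‖z‖ ^ (2 * m)) / 2 < (wCoord m ξ z).re := by
  have hm0 : 0 < m := by linarith
  rw [wCoord_re hm0.ne', mul_assoc]
  by_cases hnorm : ‖z‖ = ‖ξ‖
  · have hξ : 0 < ‖ξ‖ := (norm_nonneg ξ).lt_of_ne' fun h0 => hne <| by
      rw [norm_eq_zero.1 h0, norm_eq_zero.1 (hnorm.trans h0)]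
    have hlt : ‖ξ‖ ^ (2 * (m - 1)) * (star ξ * z).re < ‖ξ‖ ^ (2 * m) := by
      rw [← rpow_two_mul_sub_one_mul_sq hm0.ne' hξ.le]
      gcongr
      exact star_mul_re_lt_sq_norm hnorm hne
    rw [hnorm, sub_self, zero_div, sub_pos]
    gcongr
  · have hle : ‖ξ‖ ^ (2 * (m - 1)) * (star ξ * z).re ≤ ‖ξ‖ ^ (2 * (m - 1)) * ‖ξ‖ * ‖z‖ := by
      rw [mul_assoc]
      gcongr
      simpa [Complex.inner, mul_comm] using real_inner_le_norm ξ z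
    linarith [two_mul_rpow_mul_lt hm (norm_nonneg ξ) (norm_nonneg z) (Ne.symm hnorm),
      mul_le_mul_of_nonneg_left hle hm0.le]

lemma le_wCoord_re (hm : 1 / 2 < m) (ξ z : ℂ) :
    (‖ξ‖ ^ (2 * m) - ‖z‖ ^ (2 * m)) / 2 ≤ (wCoord m ξ z).re := by
  rcases eq_or_ne z ξ with rfl | hne
  · simp [wCoord]
  · exact (lt_wCoord_re hm hne).le

lemma measurable_wCoord (m : ℝ) (z : ℂ) : Measurable fun ξ => wCoord m ξ z := by
  have hstar : Measurable fun ξ : ℂ => star ξ := continuous_star.measurable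
  unfold wCoord
  fun_prop

lemma continuous_wCoord_comp {X : Type*} [TopologicalSpace X] (hm : 1 ≤ m) {f g : X → ℂ}
    (hf : Continuous f) (hg : Continuous g) : Continuous fun x => wCoord m (f x) (g x) := by
  have hpow : Continuous fun x => ‖f x‖ ^ (2 * (m - 1)) :=
    hf.norm.rpow_const fun _ => Or.inr (by linarith)
  unfold wCoord
  fun_prop

end Coordinate

section Ellipsoid

variable {m₁ m₂ : ℝ}

/-- The defining function `ρ(z) = |z₁| ^ (2 m₁) + |z₂| ^ (2 m₂)` of the ellipsoid. -/
def rho (m₁ m₂ : ℝ) (z : ℂ × ℂ) : ℝ := ‖z.1‖ ^ (2 * m₁) + ‖z.2‖ ^ (2 * m₂)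

lemma mem_bdry_iff {ξ : ℂ × ℂ} : ξ ∈ bdry m₁ m₂ ↔ rho m₁ m₂ ξ = 1 := Iff.rfl

lemma continuous_rho (hm₁ : 0 ≤ m₁) (hm₂ : 0 ≤ m₂) : Continuous (rho m₁ m₂) :=
  (continuous_fst.norm.rpow_const fun _ => Or.inr (by linarith)).add
    (continuous_snd.norm.rpow_const fun _ => Or.inr (by linarith))

lemma rho_zero (hm₁ : m₁ ≠ 0) (hm₂ : m₂ ≠ 0) : rho m₁ m₂ 0 = 0 := by
  simp [rho, hm₁, hm₂]

lemma norm_smul_rpow_le {m r : ℝ} (hm : 1 / 2 ≤ m) (hr : r ∈ Icc (0 : ℝ) 1) (u : ℂ) :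
    ‖r • u‖ ^ (2 * m) ≤ r * ‖u‖ ^ (2 * m) := by
  rw [norm_smul, norm_of_nonneg hr.1, mul_rpow hr.1 (norm_nonneg _)]
  gcongr
  exact rpow_le_self_of_le_one hr.1 hr.2 (by linarith)

lemma rho_smul_le {r : ℝ} (hm₁ : 1 / 2 ≤ m₁) (hm₂ : 1 / 2 ≤ m₂) (hr : r ∈ Icc (0 : ℝ) 1)
    (z : ℂ × ℂ) : rho m₁ m₂ (r • z) ≤ r * rho m₁ m₂ z := by
  rw [rho, rho, mul_add]
  exact add_le_add (norm_smul_rpow_le hm₁ hr z.1) (norm_smul_rpow_le hm₂ hr z.2)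

lemma rho_smul_le_of_mem_bdry {r : ℝ} (hm₁ : 1 / 2 ≤ m₁) (hm₂ : 1 / 2 ≤ m₂) {z : ℂ × ℂ}
    (hz : z ∈ bdry m₁ m₂) (hr : r ∈ Icc (0 : ℝ) 1) : rho m₁ m₂ (r • z) ≤ r :=
  (rho_smul_le hm₁ hm₂ hr z).trans_eq (by rw [mem_bdry_iff.1 hz, mul_one])

lemma le_w_re (hm₁ : 1 / 2 < m₁) (hm₂ : 1 / 2 < m₂) {ξ : ℂ × ℂ} (hξ : ξ ∈ bdry m₁ m₂)
    (z : ℂ × ℂ) : (1 - rho m₁ m₂ z) / 2 ≤ (w m₁ m₂ ξ z).re := by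
  rw [w_eq_wCoord_add, Complex.add_re, ← mem_bdry_iff.1 hξ, rho, rho]
  linarith [le_wCoord_re hm₁ ξ.1 z.1, le_wCoord_re hm₂ ξ.2 z.2]

lemma le_norm_w (hm₁ : 1 / 2 < m₁) (hm₂ : 1 / 2 < m₂) {ξ : ℂ × ℂ} (hξ : ξ ∈ bdry m₁ m₂)
    (z : ℂ × ℂ) : (1 - rho m₁ m₂ z) / 2 ≤ ‖w m₁ m₂ ξ z‖ :=
  (le_w_re hm₁ hm₂ hξ z).trans (Complex.re_le_norm _)

lemma w_ne_zero (hm₁ : 1 / 2 < m₁) (hm₂ : 1 / 2 < m₂) {ξ z : ℂ × ℂ} (hξ : ξ ∈ bdry m₁ m₂)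
    (hz : rho m₁ m₂ z ≤ 1) (hne : z ≠ ξ) : w m₁ m₂ ξ z ≠ 0 := by
  intro hw
  have hre : (wCoord m₁ ξ.1 z.1).re + (wCoord m₂ ξ.2 z.2).re = 0 := by
    rw [← Complex.add_re, ← w_eq_wCoord_add, hw, Complex.zero_re]
  have hρ : rho m₁ m₂ z ≤ rho m₁ m₂ ξ := hz.trans_eq (mem_bdry_iff.1 hξ).symm
  simp only [rho] at hρ
  have h₁ := le_wCoord_re hm₁ ξ.1 z.1
  have h₂ := le_wCoord_re hm₂ ξ.2 z.2
  refine hne (Prod.ext ?_ ?_) <;> by_contra hcoord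
  · linarith [lt_wCoord_re hm₁ hcoord]
  · linarith [lt_wCoord_re hm₂ hcoord]

lemma measurable_w (m₁ m₂ : ℝ) (z : ℂ × ℂ) : Measurable fun ξ => w m₁ m₂ ξ z := by
  simp only [w_eq_wCoord_add]
  exact ((measurable_wCoord m₁ z.1).comp measurable_fst).add
    ((measurable_wCoord m₂ z.2).comp measurable_snd)

lemma continuous_w_comp {X : Type*} [TopologicalSpace X] (hm₁ : 1 ≤ m₁) (hm₂ : 1 ≤ m₂)
    {f g : X → ℂ × ℂ} (hf : Continuous f) (hg : Continuous g) :
    Continuous fun x => w m₁ m₂ (f x) (g x) := by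
  simp only [w_eq_wCoord_add]
  exact (continuous_wCoord_comp hm₁ hf.fst hg.fst).add (continuous_wCoord_comp hm₂ hf.snd hg.snd)

lemma measurableSet_bdry (m₁ m₂ : ℝ) : MeasurableSet (bdry m₁ m₂) :=
  measurableSet_eq_fun (by fun_prop) measurable_const

lemma norm_le_one_of_rpow_le_one {m : ℝ} (hm : 0 < m) {u : ℂ} (hu : ‖u‖ ^ (2 * m) ≤ 1) :
    ‖u‖ ≤ 1 :=
  le_of_not_gt fun h => hu.not_gt (one_lt_rpow h (by positivity))

lemma norm_fst_rpow_le_one {ξ : ℂ × ℂ} (hξ : ξ ∈ bdry m₁ m₂) : ‖ξ.1‖ ^ (2 * m₁) ≤ 1 := by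
  rw [← mem_bdry_iff.1 hξ, rho]
  exact le_add_of_nonneg_right (by positivity)

lemma norm_snd_rpow_le_one {ξ : ℂ × ℂ} (hξ : ξ ∈ bdry m₁ m₂) : ‖ξ.2‖ ^ (2 * m₂) ≤ 1 := by
  rw [← mem_bdry_iff.1 hξ, rho]
  exact le_add_of_nonneg_left (by positivity)

lemma isCompact_bdry (hm₁ : 0 < m₁) (hm₂ : 0 < m₂) : IsCompact (bdry m₁ m₂) := by
  refine Metric.isCompact_of_isClosed_isBounded
    (isClosed_eq (continuous_rho hm₁.le hm₂.le) continuous_const)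
    ((Metric.isBounded_closedBall (x := (0 : ℂ × ℂ)) (r := 1)).subset fun ξ hξ => ?_)
  rw [mem_closedBall_zero_iff, Prod.norm_def]
  exact max_le (norm_le_one_of_rpow_le_one hm₁ (norm_fst_rpow_le_one hξ))
    (norm_le_one_of_rpow_le_one hm₂ (norm_snd_rpow_le_one hξ))

end Ellipsoid

section Parametrization

variable {m₁ m₂ : ℝ}

/-- The modulus `r₂ = (1 - r₁ ^ (2 m₁)) ^ (1 / (2 m₂))` of the second coordinate of `param`, as a
function of `r₁`. -/
def paramRadius (m₁ m₂ r : ℝ) : ℝ := (1 - r ^ (2 * m₁)) ^ (1 / (2 * m₂))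

lemma param_eq (m₁ m₂ r θ φ : ℝ) :
    param m₁ m₂ (r, θ, φ) = ((r : ℂ) * Complex.exp (θ * Complex.I),
      (paramRadius m₁ m₂ r : ℂ) * Complex.exp (φ * Complex.I)) := rfl

lemma measurable_param (m₁ m₂ : ℝ) : Measurable (param m₁ m₂) := by
  unfold param
  fun_prop

lemma one_sub_rpow_pos {r : ℝ} (hm₁ : 0 < m₁) (hr : r ∈ Ioo (0 : ℝ) 1) : 0 < 1 - r ^ (2 * m₁) :=
  sub_pos.2 (rpow_lt_one hr.1.le hr.2 (by positivity))

lemma paramRadius_pos {r : ℝ} (hm₁ : 0 < m₁) (m₂ : ℝ) (hr : r ∈ Ioo (0 : ℝ) 1) :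
    0 < paramRadius m₁ m₂ r :=
  rpow_pos_of_pos (one_sub_rpow_pos hm₁ hr) _

lemma paramRadius_rpow {r : ℝ} (hm₁ : 0 < m₁) (hm₂ : m₂ ≠ 0) (hr : r ∈ Ioo (0 : ℝ) 1) :
    paramRadius m₁ m₂ r ^ (2 * m₂) = 1 - r ^ (2 * m₁) := by
  rw [paramRadius, ← rpow_mul (one_sub_rpow_pos hm₁ hr).le,
    one_div_mul_cancel (mul_ne_zero two_ne_zero hm₂), rpow_one]

lemma norm_ofReal_mul_exp {r : ℝ} (hr : 0 ≤ r) (θ : ℝ) :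
    ‖(r : ℂ) * Complex.exp (θ * Complex.I)‖ = r := by
  rw [norm_mul, Complex.norm_exp_ofReal_mul_I, mul_one, Complex.norm_real, norm_of_nonneg hr]

lemma norm_param_fst (m₁ m₂ : ℝ) {t : ℝ × ℝ × ℝ} (ht : 0 ≤ t.1) : ‖(param m₁ m₂ t).1‖ = t.1 :=
  norm_ofReal_mul_exp ht _

lemma param_mem_bdry (hm₁ : 0 < m₁) (hm₂ : m₂ ≠ 0) {t : ℝ × ℝ × ℝ} (ht : t.1 ∈ Ioo (0 : ℝ) 1) :
    param m₁ m₂ t ∈ bdry m₁ m₂ := by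
  have hsnd : ‖(param m₁ m₂ t).2‖ = paramRadius m₁ m₂ t.1 :=
    norm_ofReal_mul_exp (paramRadius_pos hm₁ m₂ ht).le _
  rw [mem_bdry_iff, rho, norm_param_fst m₁ m₂ ht.1.le, hsnd, paramRadius_rpow hm₁ hm₂ ht]
  ring

lemma arg_ofReal_mul_exp {r θ : ℝ} (hr : 0 < r) (hθ : θ ∈ Ioc (-π) π) :
    Complex.arg ((r : ℂ) * Complex.exp (θ * Complex.I)) = θ := by
  rw [Complex.exp_mul_I, Complex.arg_mul_cos_add_sin_mul_I hr hθ]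

lemma arg_param_fst (m₁ m₂ : ℝ) {t : ℝ × ℝ × ℝ} (ht : t ∈ paramDomain) :
    Complex.arg (param m₁ m₂ t).1 = t.2.1 :=
  arg_ofReal_mul_exp ht.1.1 ht.2.1

lemma arg_param_snd (hm₁ : 0 < m₁) (m₂ : ℝ) {t : ℝ × ℝ × ℝ} (ht : t ∈ paramDomain) :
    Complex.arg (param m₁ m₂ t).2 = t.2.2 :=
  arg_ofReal_mul_exp (paramRadius_pos hm₁ m₂ ht.1) ht.2.2

lemma hasDerivAt_paramRadius {r : ℝ} (hm₁ : 0 < m₁) (m₂ : ℝ) (hr : r ∈ Ioo (0 : ℝ) 1) :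
    HasDerivAt (paramRadius m₁ m₂)
      (-(m₁ * r ^ (2 * m₁ - 1) * paramRadius m₁ m₂ r) / (m₂ * (1 - r ^ (2 * m₁)))) r := by
  have hpos := one_sub_rpow_pos hm₁ hr
  have hbase : HasDerivAt (fun r : ℝ => 1 - r ^ (2 * m₁)) (-(2 * m₁ * r ^ (2 * m₁ - 1))) r := by
    simpa using (hasDerivAt_rpow_const (Or.inl hr.1.ne')).const_sub 1
  refine (hbase.rpow_const (p := 1 / (2 * m₂)) (Or.inl hpos.ne')).congr_deriv ?_
  rw [rpow_sub_one hpos.ne', paramRadius]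
  field_simp

lemma hasDerivAt_exp_mul_I (θ : ℝ) :
    HasDerivAt (fun θ : ℝ => Complex.exp (θ * Complex.I))
      (Complex.exp (θ * Complex.I) * Complex.I) θ := by
  simpa using ((hasDerivAt_id θ).ofReal_comp.mul_const Complex.I).cexp

lemma deriv_param_fst {r : ℝ} (hm₁ : 0 < m₁) (m₂ : ℝ) (hr : r ∈ Ioo (0 : ℝ) 1) (θ φ : ℝ) :
    deriv (fun r : ℝ => param m₁ m₂ (r, θ, φ)) r = (Complex.exp (θ * Complex.I),
      ((-(m₁ * r ^ (2 * m₁ - 1) * paramRadius m₁ m₂ r) / (m₂ * (1 - r ^ (2 * m₁))) : ℝ) : ℂ)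
        * Complex.exp (φ * Complex.I)) := by
  refine (HasDerivAt.prodMk ?_ ?_).deriv
  · simpa using (hasDerivAt_id r).ofReal_comp.mul_const (Complex.exp (θ * Complex.I))
  · exact (hasDerivAt_paramRadius hm₁ m₂ hr).ofReal_comp.mul_const (Complex.exp (φ * Complex.I))

lemma deriv_param_snd (m₁ m₂ r θ φ : ℝ) :
    deriv (fun θ : ℝ => param m₁ m₂ (r, θ, φ)) θ
      = ((r : ℂ) * (Complex.exp (θ * Complex.I) * Complex.I), 0) :=
  (((hasDerivAt_exp_mul_I θ).const_mul (r : ℂ)).prodMk (hasDerivAt_const θ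
    ((paramRadius m₁ m₂ r : ℂ) * Complex.exp (φ * Complex.I)))).deriv

lemma deriv_param_thd (m₁ m₂ r θ φ : ℝ) :
    deriv (fun φ : ℝ => param m₁ m₂ (r, θ, φ)) φ
      = (0, (paramRadius m₁ m₂ r : ℂ) * (Complex.exp (φ * Complex.I) * Complex.I)) :=
  ((hasDerivAt_const φ ((r : ℂ) * Complex.exp (θ * Complex.I))).prodMk
    ((hasDerivAt_exp_mul_I φ).const_mul (paramRadius m₁ m₂ r : ℂ))).deriv

lemma lerayForm_polar (m₁ m₂ R' : ℝ) {r R : ℝ} (hr : 0 ≤ r) (hR : 0 ≤ R) {u v : ℂ} (hu : ‖u‖ = 1)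
    (hv : ‖v‖ = 1) :
    lerayForm m₁ m₂ ((r : ℂ) * u, (R : ℂ) * v) (u, (R' : ℂ) * v)
        ((r : ℂ) * (u * Complex.I), 0) (0, (R : ℂ) * (v * Complex.I))
      = ((2 * m₁ * m₂ * (r ^ (2 * (m₁ - 1)) * r) * (R ^ (2 * (m₂ - 1)) * R)
          * (m₂ * r * R' - m₁ * R) : ℝ) : ℂ) := by
  have hu' : (starRingEnd ℂ) u * u = 1 := by rw [Complex.conj_mul', hu]; norm_num
  have hv' : (starRingEnd ℂ) v * v = 1 := by rw [Complex.conj_mul', hv]; norm_num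
  have hru : ‖(r : ℂ) * u‖ = r := by
    rw [norm_mul, hu, Complex.norm_real, norm_of_nonneg hr, mul_one]
  have hRv : ‖(R : ℂ) * v‖ = R := by
    rw [norm_mul, hv, Complex.norm_real, norm_of_nonneg hR, mul_one]
  simp only [lerayForm, dRho, ddRho, hru, hRv, star_mul', Complex.star_def, Complex.conj_ofReal,
    Complex.conj_I, map_zero, mul_zero, zero_mul, sub_zero, add_zero, zero_add, zero_sub]
  push_cast
  generalize ((r ^ (2 * (m₁ - 1)) : ℝ) : ℂ) = x
  generalize ((R ^ (2 * (m₂ - 1)) : ℝ) : ℂ) = y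
  linear_combination
    (2 * m₁ * m₂ * (x * r) * (y * R) * (m₁ * R - m₂ * r * R') : ℂ) *
      ((starRingEnd ℂ) u * u * ((starRingEnd ℂ) v * v) * Complex.I_sq
        - (starRingEnd ℂ) v * v * hu' - hv')

lemma lerayDensity_eq (hm₁ : 0 < m₁) (hm₂ : 0 < m₂) {t : ℝ × ℝ × ℝ} (ht : t.1 ∈ Ioo (0 : ℝ) 1) :
    lerayDensity m₁ m₂ t = 2 * m₁ ^ 2 * m₂ * t.1 ^ (2 * m₁ - 1) := by
  obtain ⟨r, θ, φ⟩ := t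
  have hs : 0 < 1 - r ^ (2 * m₁) := one_sub_rpow_pos hm₁ ht
  have hr : r ^ (2 * m₁) = r ^ (2 * m₁ - 1) * r := by
    rw [← rpow_add_one ht.1.ne', sub_add_cancel]
  have hr' : r ^ (2 * (m₁ - 1)) * r = r ^ (2 * m₁ - 1) := by
    rw [← rpow_add_one ht.1.ne']
    congr 1
    ring
  have hR := paramRadius_pos hm₁ m₂ ht
  have hR' : paramRadius m₁ m₂ r ^ (2 * (m₂ - 1)) * paramRadius m₁ m₂ r ^ 2
      = 1 - r ^ (2 * m₁) := by
    rw [rpow_two_mul_sub_one_mul_sq hm₂.ne' hR.le, paramRadius_rpow hm₁ hm₂.ne' ht]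
  have hfactor : m₂ * r * (-(m₁ * r ^ (2 * m₁ - 1) * paramRadius m₁ m₂ r)
        / (m₂ * (1 - r ^ (2 * m₁)))) - m₁ * paramRadius m₁ m₂ r
      = -(m₁ * paramRadius m₁ m₂ r) / (1 - r ^ (2 * m₁)) := by
    have hr_mul : r ^ (2 * m₁ - 1) * r = 1 - (1 - r ^ (2 * m₁)) := by rw [hr]; ring
    generalize 1 - r ^ (2 * m₁) = s, r ^ (2 * m₁ - 1) = x at hs hr_mul ⊢
    field_simp
    linear_combination -hr_mul
  have hvalue : 2 * m₁ * m₂ * r ^ (2 * m₁ - 1)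
        * (paramRadius m₁ m₂ r ^ (2 * (m₂ - 1)) * paramRadius m₁ m₂ r)
        * (-(m₁ * paramRadius m₁ m₂ r) / (1 - r ^ (2 * m₁)))
      = -(2 * m₁ ^ 2 * m₂ * r ^ (2 * m₁ - 1)) := by
    rw [mul_div_assoc', div_eq_iff hs.ne', ← hR']
    ring
  have hnonneg : 0 ≤ 2 * m₁ ^ 2 * m₂ * r ^ (2 * m₁ - 1) :=
    mul_nonneg (by positivity) (rpow_nonneg ht.1.le _)
  rw [lerayDensity, param_eq, deriv_param_fst hm₁ m₂ ht, deriv_param_snd, deriv_param_thd,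
    lerayForm_polar m₁ m₂ _ ht.1.le hR.le (Complex.norm_exp_ofReal_mul_I θ)
      (Complex.norm_exp_ofReal_mul_I φ), hfactor, hr', hvalue, Complex.norm_real, norm_neg,
    norm_of_nonneg hnonneg]

end Parametrization

section Measure

variable {m₁ m₂ : ℝ}

/-- The distribution of an angle `θⱼ`: Lebesgue measure on `(-π, π]`. -/
def angleMeasure : Measure ℝ := volume.restrict (Ioc (-π) π)

instance : IsFiniteMeasure angleMeasure := by
  unfold angleMeasure
  infer_instance

/-- The distribution of the modulus `r₁` under `dS`, up to the factor coming from the angles. -/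
def radialMeasure (m₁ m₂ : ℝ) : Measure ℝ :=
  (volume.restrict (Ioo (0 : ℝ) 1)).withDensity
    fun r => ENNReal.ofReal (2 * m₁ ^ 2 * m₂ * r ^ (2 * m₁ - 1))

instance (m₁ m₂ : ℝ) : SigmaFinite (radialMeasure m₁ m₂) := by
  unfold radialMeasure
  infer_instance

/-- The measure `dS` in the polar coordinates `(r₁, θ₁, θ₂)` of `param`. -/
def paramMeasure (m₁ m₂ : ℝ) : Measure (ℝ × ℝ × ℝ) :=
  (radialMeasure m₁ m₂).prod (angleMeasure.prod angleMeasure)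

lemma lerayMeasure_eq_map (hm₁ : 0 < m₁) (hm₂ : 0 < m₂) :
    lerayMeasure m₁ m₂ = (paramMeasure m₁ m₂).map (param m₁ m₂) := by
  have hdomain : MeasurableSet paramDomain :=
    measurableSet_Ioo.prod (measurableSet_Ioc.prod measurableSet_Ioc)
  rw [lerayMeasure, paramMeasure, radialMeasure, angleMeasure,
    prod_withDensity_left (by fun_prop), Measure.prod_restrict, Measure.prod_restrict,
    ← Measure.volume_eq_prod, ← Measure.volume_eq_prod, ← paramDomain]
  congr 1
  refine withDensity_congr_ae ?_
  filter_upwards [ae_restrict_mem hdomain] with t ht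
  rw [lerayDensity_eq hm₁ hm₂ ht.1]

lemma isFiniteMeasure_radialMeasure (hm₁ : 0 < m₁) (m₂ : ℝ) :
    IsFiniteMeasure (radialMeasure m₁ m₂) := by
  refine isFiniteMeasure_withDensity_ofReal (Integrable.hasFiniteIntegral ?_)
  have hint : IntervalIntegrable (fun r : ℝ => 2 * m₁ ^ 2 * m₂ * r ^ (2 * m₁ - 1)) volume 0 1 :=
    (intervalIntegral.intervalIntegrable_rpow' (by linarith)).const_mul _
  exact hint.1.mono_set Ioo_subset_Ioc_self

lemma isFiniteMeasure_lerayMeasure (hm₁ : 0 < m₁) (hm₂ : 0 < m₂) :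
    IsFiniteMeasure (lerayMeasure m₁ m₂) := by
  have := isFiniteMeasure_radialMeasure hm₁ m₂
  rw [lerayMeasure_eq_map hm₁ hm₂, paramMeasure]
  infer_instance

lemma ae_radialMeasure_mem_Ioo (m₁ m₂ : ℝ) : ∀ᵐ r ∂(radialMeasure m₁ m₂), r ∈ Ioo (0 : ℝ) 1 :=
  (withDensity_absolutelyContinuous _ _).ae_le (ae_restrict_mem measurableSet_Ioo)

lemma ae_paramMeasure_of_ae {P Q : ℝ → Prop} (hP : ∀ᵐ r ∂(radialMeasure m₁ m₂), P r)
    (hQ : ∀ᵐ θ ∂angleMeasure, Q θ) :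
    ∀ᵐ t ∂(paramMeasure m₁ m₂), P t.1 ∧ Q t.2.1 ∧ Q t.2.2 := by
  have hangles : ∀ᵐ s ∂(angleMeasure.prod angleMeasure), Q s.1 ∧ Q s.2 :=
    (Measure.quasiMeasurePreserving_fst.ae hQ).and (Measure.quasiMeasurePreserving_snd.ae hQ)
  exact (Measure.quasiMeasurePreserving_fst.ae hP).and
    (Measure.quasiMeasurePreserving_snd.ae hangles)

lemma ae_mem_paramDomain (m₁ m₂ : ℝ) : ∀ᵐ t ∂(paramMeasure m₁ m₂), t ∈ paramDomain :=
  ae_paramMeasure_of_ae (ae_radialMeasure_mem_Ioo m₁ m₂) (ae_restrict_mem measurableSet_Ioc)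

lemma ae_paramMeasure_notMem_of_countable (m₁ m₂ : ℝ) {S : Set ℝ} (hS : S.Countable) :
    ∀ᵐ t ∂(paramMeasure m₁ m₂), t.1 ∉ S ∧ t.2.1 ∉ S ∧ t.2.2 ∉ S :=
  ae_paramMeasure_of_ae
    ((withDensity_absolutelyContinuous _ _).ae_le (ae_restrict_of_ae (hS.ae_notMem volume)))
    (ae_restrict_of_ae (hS.ae_notMem volume))

/-- The boundary points whose coordinates `θ₁`, `θ₂` and `r₁ ^ (2 m₁)` lie in `I`, `J` and `K`. -/
def box (m₁ m₂ : ℝ) (I J K : Set ℝ) : Set (ℂ × ℂ) :=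
  {ξ | ξ ∈ bdry m₁ m₂ ∧ Complex.arg ξ.1 ∈ I ∧ Complex.arg ξ.2 ∈ J ∧ ‖ξ.1‖ ^ (2 * m₁) ∈ K}

lemma measurableSet_box (m₁ m₂ : ℝ) {I J K : Set ℝ} (hI : MeasurableSet I) (hJ : MeasurableSet J)
    (hK : MeasurableSet K) : MeasurableSet (box m₁ m₂ I J K) := by
  have hnorm : Measurable fun ξ : ℂ × ℂ => ‖ξ.1‖ ^ (2 * m₁) := by fun_prop
  exact (measurableSet_bdry m₁ m₂).inter (((Complex.measurable_arg.comp measurable_fst) hI).inter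
    (((Complex.measurable_arg.comp measurable_snd) hJ).inter (hnorm hK)))

lemma ae_mem_bdry (hm₁ : 0 < m₁) (hm₂ : 0 < m₂) : ∀ᵐ ξ ∂(lerayMeasure m₁ m₂), ξ ∈ bdry m₁ m₂ := by
  rw [lerayMeasure_eq_map hm₁ hm₂]
  refine (ae_map_iff (measurable_param m₁ m₂).aemeasurable (measurableSet_bdry m₁ m₂)).2 ?_
  filter_upwards [ae_mem_paramDomain m₁ m₂] with t ht using param_mem_bdry hm₁ hm₂.ne' ht.1

lemma param_mem_box_iff (hm₁ : 0 < m₁) (hm₂ : m₂ ≠ 0) {I J K : Set ℝ} {t : ℝ × ℝ × ℝ}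
    (ht : t ∈ paramDomain) :
    param m₁ m₂ t ∈ box m₁ m₂ I J K ↔ t.2.1 ∈ I ∧ t.2.2 ∈ J ∧ t.1 ^ (2 * m₁) ∈ K := by
  rw [box, mem_ofPred_eq, arg_param_fst m₁ m₂ ht, arg_param_snd hm₁ m₂ ht,
    norm_param_fst m₁ m₂ ht.1.1.le]
  exact and_iff_right (param_mem_bdry hm₁ hm₂ ht.1)

lemma ae_mem_box_compl_of_countable (hm₁ : 0 < m₁) (hm₂ : 0 < m₂) {S : Set ℝ} (hS : S.Countable) :
    ∀ᵐ ξ ∂(lerayMeasure m₁ m₂), ξ ∈ box m₁ m₂ Sᶜ Sᶜ Sᶜ := by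
  have hSc := hS.measurableSet.compl
  rw [lerayMeasure_eq_map hm₁ hm₂]
  refine (ae_map_iff (measurable_param m₁ m₂).aemeasurable
    (measurableSet_box m₁ m₂ hSc hSc hSc)).2 ?_
  filter_upwards [ae_mem_paramDomain m₁ m₂, ae_paramMeasure_notMem_of_countable m₁ m₂ hS,
    ae_paramMeasure_notMem_of_countable m₁ m₂ (hS.image fun s => s ^ (2 * m₁)⁻¹)]
    with t ht hangles hradius
  exact (param_mem_box_iff hm₁ hm₂.ne' ht).2 ⟨hangles.2.1, hangles.2.2,
    fun hmem => hradius.1 ⟨_, hmem, rpow_rpow_inv ht.1.1.le (by positivity)⟩⟩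

lemma setOf_rpow_mem_Icc_inter_Ioo {q a b : ℝ} (hq : 0 < q) (ha : 0 < a) (hb₀ : 0 ≤ b)
    (hb : b < 1) :
    {r : ℝ | r ^ q ∈ Icc a b} ∩ Ioo 0 1 = Icc (a ^ q⁻¹) (b ^ q⁻¹) := by
  ext r
  constructor
  · rintro ⟨⟨har, hrb⟩, hr⟩
    exact ⟨(rpow_inv_le_iff_of_pos ha.le hr.1.le hq).2 har,
      (le_rpow_inv_iff_of_pos hr.1.le hb₀ hq).2 hrb⟩
  · rintro ⟨har, hrb⟩
    have hr : 0 < r := (rpow_pos_of_pos ha _).trans_le har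
    exact ⟨⟨(rpow_inv_le_iff_of_pos ha.le hr.le hq).1 har,
      (le_rpow_inv_iff_of_pos hr.le hb₀ hq).1 hrb⟩, hr,
      hrb.trans_lt (rpow_lt_one hb₀ hb (by positivity))⟩

lemma radialMeasure_Icc (hm₁ : 0 < m₁) (hm₂ : 0 ≤ m₂) {a b : ℝ} (ha : 0 < a) (hab : a ≤ b)
    (hb : b < 1) :
    radialMeasure m₁ m₂ (Icc a b)
      = ENNReal.ofReal (m₁ * m₂ * (b ^ (2 * m₁) - a ^ (2 * m₁))) := by
  have hsub : Icc a b ⊆ Ioo 0 1 := Icc_subset_Ioo ha hb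
  have hint : IntervalIntegrable (fun r : ℝ => 2 * m₁ ^ 2 * m₂ * r ^ (2 * m₁ - 1)) volume a b :=
    (intervalIntegral.intervalIntegrable_rpow' (by linarith)).const_mul _
  rw [radialMeasure, withDensity_apply _ measurableSet_Icc,
    Measure.restrict_restrict measurableSet_Icc, inter_eq_left.2 hsub,
    ← ofReal_integral_eq_lintegral_ofReal, integral_Icc_eq_integral_Ioc,
    ← intervalIntegral.integral_of_le hab, intervalIntegral.integral_const_mul,
    integral_rpow (Or.inl (by linarith)), sub_add_cancel]
  · congr 1
    field_simp
  · exact (intervalIntegrable_iff_integrableOn_Icc_of_le hab).1 hint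
  · filter_upwards [ae_restrict_mem measurableSet_Icc] with r hr
    exact mul_nonneg (by positivity) (rpow_nonneg (hsub hr).1.le _)

lemma radialMeasure_rpow_mem_Icc (hm₁ : 0 < m₁) (hm₂ : 0 ≤ m₂) {a b : ℝ} (ha : 0 < a)
    (hab : a ≤ b) (hb : b < 1) :
    radialMeasure m₁ m₂ ({r | r ^ (2 * m₁) ∈ Icc a b} ∩ Ioo 0 1)
      = ENNReal.ofReal (m₁ * m₂ * (b - a)) := by
  have hb₀ : 0 ≤ b := ha.le.trans hab
  rw [setOf_rpow_mem_Icc_inter_Ioo (by positivity) ha hb₀ hb, radialMeasure_Icc hm₁ hm₂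
    (rpow_pos_of_pos ha _) (by gcongr) (rpow_lt_one hb₀ hb (by positivity)),
    rpow_inv_rpow hb₀ (by positivity), rpow_inv_rpow ha.le (by positivity)]

lemma lerayMeasure_box (hm₁ : 0 < m₁) (hm₂ : 0 < m₂) {I J : Set ℝ} (hI : MeasurableSet I)
    (hJ : MeasurableSet J) (hI' : I ⊆ Ioc (-π) π) (hJ' : J ⊆ Ioc (-π) π) {a b : ℝ} (ha : 0 < a)
    (hab : a ≤ b) (hb : b < 1) :
    lerayMeasure m₁ m₂ (box m₁ m₂ I J (Icc a b))
      = ENNReal.ofReal (m₁ * m₂ * (b - a)) * (volume I * volume J) := by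
  have hpreimage : param m₁ m₂ ⁻¹' box m₁ m₂ I J (Icc a b) =ᵐ[paramMeasure m₁ m₂]
      (({r : ℝ | r ^ (2 * m₁) ∈ Icc a b} ∩ Ioo 0 1) ×ˢ I ×ˢ J : Set (ℝ × ℝ × ℝ)) := by
    filter_upwards [ae_mem_paramDomain m₁ m₂] with t ht
    refine propext ((param_mem_box_iff hm₁ hm₂.ne' ht).trans ?_)
    exact ⟨fun ⟨hθ, hφ, hr⟩ => ⟨⟨hr, ht.1⟩, hθ, hφ⟩, fun ⟨⟨hr, _⟩, hθ, hφ⟩ => ⟨hθ, hφ, hr⟩⟩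
  rw [lerayMeasure_eq_map hm₁ hm₂, Measure.map_apply (measurable_param m₁ m₂)
    (measurableSet_box m₁ m₂ hI hJ measurableSet_Icc), measure_congr hpreimage, paramMeasure,
    angleMeasure, Measure.prod_prod, Measure.prod_prod,
    radialMeasure_rpow_mem_Icc hm₁ hm₂.le ha hab hb, Measure.restrict_apply hI,
    Measure.restrict_apply hJ, inter_eq_left.2 hI', inter_eq_left.2 hJ']

end Measure

section MeanValue

lemma integral_star_exp_of_diffContOnCl {F : ℂ → ℂ} (hF : DiffContOnCl ℂ F (Metric.ball 0 1)) :
    ∫ θ, F (star (Complex.exp ((θ : ℝ) * Complex.I))) ∂angleMeasure = 2 * π * F 0 := by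
  have hmean : ∫ θ in 0..(2 * π), F (circleMap 0 1 θ) = 2 * π * F 0 := by
    have haverage := (show DiffContOnCl ℂ F (Metric.ball 0 |1|) by rwa [abs_one]).circleAverage
    rw [Real.circleAverage_def, inv_smul_eq_iff₀ two_pi_pos.ne'] at haverage
    rw [haverage, Complex.real_smul]
    push_cast
    rfl
  have hperiodic : Function.Periodic (fun θ : ℝ => F (circleMap 0 1 θ)) (2 * π) := fun θ => by
    simp only [periodic_circleMap 0 1 θ]
  have hshift := hperiodic.intervalIntegral_add_eq (-π) 0
  rw [zero_add, show -π + 2 * π = π by ring] at hshift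
  have hstar (θ : ℝ) : star (Complex.exp (θ * Complex.I)) = circleMap 0 1 (-θ) := by
    simp [circleMap, ← Complex.exp_conj]
  rw [angleMeasure, ← intervalIntegral.integral_of_le (by linarith [pi_pos])]
  simp only [hstar]
  rw [intervalIntegral.integral_comp_neg (fun θ => F (circleMap 0 1 θ)), neg_neg, hshift, hmean]

lemma integral_one_div_sub_mul_star_exp_sq {c b : ℂ} (hbc : ‖b‖ < ‖c‖) :
    ∫ θ, 1 / (c - b * star (Complex.exp ((θ : ℝ) * Complex.I))) ^ 2 ∂angleMeasure
      = 2 * π * (1 / c ^ 2) := by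
  have hne : ∀ u ∈ Metric.closedBall (0 : ℂ) 1, c - b * u ≠ 0 := by
    intro u hu h0
    refine hbc.not_ge ?_
    rw [sub_eq_zero.1 h0, norm_mul]
    exact mul_le_of_le_one_right (norm_nonneg b) (mem_closedBall_zero_iff.1 hu)
  have hdiff : DiffContOnCl ℂ (fun u => 1 / (c - b * u) ^ 2) (Metric.ball 0 1) := by
    refine DifferentiableOn.diffContOnCl ?_
    rw [closure_ball _ one_ne_zero]
    intro u hu
    have := hne u hu
    exact (DifferentiableAt.div (by fun_prop) (by fun_prop) (by positivity)).differentiableWithinAt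
  simpa using integral_star_exp_of_diffContOnCl hdiff

lemma norm_one_div_sq_le {η : ℝ} (hη : 0 < η) {x : ℂ} (hx : η ≤ ‖x‖) :
    ‖1 / x ^ 2‖ ≤ 1 / η ^ 2 := by
  rw [norm_div, norm_one, norm_pow]
  gcongr

lemma integral_one_div_sub_sub_sq {c b₁ b₂ : ℂ} (hbc : ‖b₁‖ + ‖b₂‖ < ‖c‖) :
    ∫ s : ℝ × ℝ, 1 / (c - b₁ * star (Complex.exp (s.1 * Complex.I))
        - b₂ * star (Complex.exp (s.2 * Complex.I))) ^ 2 ∂(angleMeasure.prod angleMeasure)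
      = (2 * π) ^ 2 / c ^ 2 := by
  have hnorm (b : ℂ) (θ : ℝ) : ‖b * star (Complex.exp (θ * Complex.I))‖ = ‖b‖ := by
    rw [norm_mul, norm_star, Complex.norm_exp_ofReal_mul_I, mul_one]
  have hle (θ : ℝ) : ‖c‖ - ‖b₁‖ ≤ ‖c - b₁ * star (Complex.exp (θ * Complex.I))‖ :=
    (norm_sub_norm_le _ _).trans_eq' (by rw [hnorm])
  have hint : Integrable (fun s : ℝ × ℝ => 1 / (c - b₁ * star (Complex.exp (s.1 * Complex.I))
      - b₂ * star (Complex.exp (s.2 * Complex.I))) ^ 2) (angleMeasure.prod angleMeasure) := by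
    refine Integrable.of_bound (C := 1 / (‖c‖ - ‖b₁‖ - ‖b₂‖) ^ 2) ?_
      (Eventually.of_forall fun s => norm_one_div_sq_le (by linarith) ?_)
    · refine Measurable.aestronglyMeasurable (measurable_const.div (Measurable.pow_const ?_ 2))
      exact Continuous.measurable (by fun_prop)
    · exact (norm_sub_norm_le _ _).trans' (by rw [hnorm]; linarith [hle s.1])
  have hinner (θ : ℝ) : ∫ φ : ℝ, 1 / (c - b₁ * star (Complex.exp (θ * Complex.I))
      - b₂ * star (Complex.exp (φ * Complex.I))) ^ 2 ∂angleMeasure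
      = 2 * π * (1 / (c - b₁ * star (Complex.exp (θ * Complex.I))) ^ 2) :=
    integral_one_div_sub_mul_star_exp_sq (by linarith [hle θ])
  rw [integral_prod _ hint]
  simp only [hinner]
  rw [integral_const_mul,
    integral_one_div_sub_mul_star_exp_sq (by linarith [norm_nonneg b₂])]
  ring

end MeanValue

section RadialLimits

variable {m₁ m₂ : ℝ}

/-- The coefficient `b` in `wCoord m (R e^{iθ}) z = m R ^ (2 m) - b e^{-iθ}`. -/
def polarCoeff (m R : ℝ) (z : ℂ) : ℂ := ((m * (R ^ (2 * (m - 1)) * R) : ℝ) : ℂ) * z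

lemma wCoord_polar {m R : ℝ} (hm : m ≠ 0) (hR : 0 ≤ R) (θ : ℝ) (z : ℂ) :
    wCoord m ((R : ℂ) * Complex.exp (θ * Complex.I)) z
      = ((m * R ^ (2 * m) : ℝ) : ℂ) - polarCoeff m R z * star (Complex.exp (θ * Complex.I)) := by
  rw [wCoord_eq_sub hm, norm_ofReal_mul_exp hR, star_mul', Complex.star_def, Complex.conj_ofReal,
    polarCoeff]
  push_cast
  ring

lemma norm_polarCoeff_le {m R : ℝ} (hm : 1 / 2 < m) (hR : 0 ≤ R) (z : ℂ) :
    ‖polarCoeff m R z‖ ≤ m * R ^ (2 * m) - (R ^ (2 * m) - ‖z‖ ^ (2 * m)) / 2 := by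
  have hcoeff : 0 ≤ m * (R ^ (2 * (m - 1)) * R) :=
    mul_nonneg (by linarith) (mul_nonneg (rpow_nonneg hR _) hR)
  rw [polarCoeff, norm_mul, Complex.norm_real, norm_of_nonneg hcoeff]
  linarith [mul_rpow_mul_le hm hR (norm_nonneg z)]

lemma integral_one_div_w_param_sq (hm₁ : 1 / 2 < m₁) (hm₂ : 1 / 2 < m₂) {z : ℂ × ℂ}
    (hz : rho m₁ m₂ z < 1) {r : ℝ} (hr : r ∈ Ioo (0 : ℝ) 1) :
    ∫ s, 1 / (w m₁ m₂ (param m₁ m₂ (r, s)) z) ^ 2 ∂(angleMeasure.prod angleMeasure)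
      = (2 * π) ^ 2 / ((m₁ * r ^ (2 * m₁) + m₂ * (1 - r ^ (2 * m₁)) : ℝ) : ℂ) ^ 2 := by
  have hm₁' : 0 < m₁ := by linarith
  have hm₂' : m₂ ≠ 0 := by linarith
  have hR := (paramRadius_pos hm₁' m₂ hr).le
  have hw (s : ℝ × ℝ) : w m₁ m₂ (param m₁ m₂ (r, s)) z
      = ((m₁ * r ^ (2 * m₁) + m₂ * (1 - r ^ (2 * m₁)) : ℝ) : ℂ)
        - polarCoeff m₁ r z.1 * star (Complex.exp (s.1 * Complex.I))
        - polarCoeff m₂ (paramRadius m₁ m₂ r) z.2 * star (Complex.exp (s.2 * Complex.I)) := by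
    rw [w_eq_wCoord_add, param_eq, wCoord_polar hm₁'.ne' hr.1.le, wCoord_polar hm₂' hR,
      paramRadius_rpow hm₁' hm₂' hr]
    push_cast
    ring
  simp only [hw]
  refine integral_one_div_sub_sub_sq ?_
  have h₁ := norm_polarCoeff_le hm₁ hr.1.le z.1
  have h₂ := norm_polarCoeff_le hm₂ hR z.2
  rw [paramRadius_rpow hm₁' hm₂' hr] at h₂
  rw [rho] at hz
  rw [Complex.norm_real]
  exact (by linarith : _ < _).trans_le (le_norm_self _)

lemma integral_one_div_w_sq (hm₁ : 1 / 2 < m₁) (hm₂ : 1 / 2 < m₂) {z : ℂ × ℂ}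
    (hz : rho m₁ m₂ z < 1) :
    ∫ ξ, 1 / (w m₁ m₂ ξ z) ^ 2 ∂(lerayMeasure m₁ m₂)
      = ∫ r, (2 * π) ^ 2 / ((m₁ * r ^ (2 * m₁) + m₂ * (1 - r ^ (2 * m₁)) : ℝ) : ℂ) ^ 2
        ∂(radialMeasure m₁ m₂) := by
  have hm₁' : 0 < m₁ := by linarith
  have hm₂' : 0 < m₂ := by linarith
  have hη : 0 < (1 - rho m₁ m₂ z) / 2 := by linarith
  have hmeas : Measurable fun ξ : ℂ × ℂ => 1 / (w m₁ m₂ ξ z) ^ 2 :=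
    measurable_const.div ((measurable_w m₁ m₂ z).pow_const 2)
  have := isFiniteMeasure_lerayMeasure hm₁' hm₂'
  have hint : Integrable (fun ξ => 1 / (w m₁ m₂ ξ z) ^ 2) (lerayMeasure m₁ m₂) := by
    refine Integrable.of_bound (C := 1 / ((1 - rho m₁ m₂ z) / 2) ^ 2)
      hmeas.aestronglyMeasurable ?_
    filter_upwards [ae_mem_bdry hm₁' hm₂'] with ξ hξ
    exact norm_one_div_sq_le hη (le_norm_w hm₁ hm₂ hξ z)
  have hparam := (measurable_param m₁ m₂).aemeasurable (μ := paramMeasure m₁ m₂)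
  rw [lerayMeasure_eq_map hm₁' hm₂'] at hint ⊢
  have hint' := (integrable_map_measure hmeas.aestronglyMeasurable hparam).1 hint
  rw [integral_map hparam hmeas.aestronglyMeasurable]
  rw [paramMeasure] at hint' ⊢
  rw [integral_prod (fun t => 1 / (w m₁ m₂ (param m₁ m₂ t) z) ^ 2) hint']
  refine integral_congr_ae ?_
  filter_upwards [ae_radialMeasure_mem_Ioo m₁ m₂] with r hr
  exact integral_one_div_w_param_sq hm₁ hm₂ hz hr

lemma cauchyLF_const (hm₁ : 1 / 2 < m₁) (hm₂ : 1 / 2 < m₂) (c : ℂ) {z : ℂ × ℂ}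
    (hz : rho m₁ m₂ z < 1) :
    cauchyLF m₁ m₂ (fun _ => c) z = cauchyLF m₁ m₂ (fun _ => c) 0 := by
  have hfactor (z : ℂ × ℂ) : ∫ ξ, c / (w m₁ m₂ ξ z) ^ 2 ∂(lerayMeasure m₁ m₂)
      = c * ∫ ξ, 1 / (w m₁ m₂ ξ z) ^ 2 ∂(lerayMeasure m₁ m₂) := by
    rw [← integral_const_mul]
    simp only [mul_one_div]
  have h0 : rho m₁ m₂ 0 < 1 := by
    rw [rho_zero (by linarith) (by linarith)]
    exact one_pos
  rw [cauchyLF, cauchyLF, hfactor, hfactor, integral_one_div_w_sq hm₁ hm₂ hz,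
    integral_one_div_w_sq hm₁ hm₂ h0]

lemma exists_eq_zero_or_le_norm_w (hm₁ : 1 ≤ m₁) (hm₂ : 1 ≤ m₂) {f : ℂ × ℂ → ℂ} {z : ℂ × ℂ}
    (hz : z ∈ bdry m₁ m₂) (hf : ∀ᶠ ξ in 𝓝[bdry m₁ m₂] z, f ξ = 0) :
    ∃ η > 0, ∀ ξ ∈ bdry m₁ m₂, ∀ r ∈ Icc (0 : ℝ) 1, f ξ = 0 ∨ η ≤ ‖w m₁ m₂ ξ (r • z)‖ := by
  obtain ⟨U, hU, hzU, hfU⟩ := mem_nhdsWithin.1 hf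
  have hcompact : IsCompact ((bdry m₁ m₂ \ U) ×ˢ Icc (0 : ℝ) 1) :=
    ((isCompact_bdry (by linarith) (by linarith)).diff hU).prod isCompact_Icc
  have hcont : Continuous fun q : (ℂ × ℂ) × ℝ => ‖w m₁ m₂ q.1 (q.2 • z)‖ :=
    (continuous_w_comp hm₁ hm₂ continuous_fst (by fun_prop)).norm
  have hpos : ∀ q ∈ (bdry m₁ m₂ \ U) ×ˢ Icc (0 : ℝ) 1, 0 < ‖w m₁ m₂ q.1 (q.2 • z)‖ := by
    rintro ⟨ξ, r⟩ ⟨⟨hξ, hξU⟩, hr⟩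
    have hle : rho m₁ m₂ (r • z) ≤ r :=
      rho_smul_le_of_mem_bdry (by linarith) (by linarith) hz hr
    refine norm_pos_iff.2 (w_ne_zero (by linarith) (by linarith) hξ (hle.trans hr.2) fun heq => ?_)
    rw [← heq] at hξ hξU
    have hr1 : r = 1 := le_antisymm hr.2 ((mem_bdry_iff.1 hξ).symm.trans_le hle)
    exact hξU (by rwa [hr1, one_smul])
  obtain ⟨η, hη, hle⟩ := hcompact.exists_forall_le' hcont.continuousOn hpos
  refine ⟨η, hη, fun ξ hξ r hr => ?_⟩
  by_cases hξU : ξ ∈ U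
  · exact Or.inl (hfU ⟨hξU, hξ⟩)
  · exact Or.inr (hle (ξ, r) ⟨⟨hξ, hξU⟩, hr⟩)

lemma norm_div_sq_le {η : ℝ} (hη : 0 < η) {a x : ℂ} (hx : a = 0 ∨ η ≤ ‖x‖) :
    ‖a / x ^ 2‖ ≤ 1 / η ^ 2 * ‖a‖ := by
  rcases hx with rfl | hx
  · simp
  · rw [← mul_one_div, norm_mul, mul_comm]
    exact mul_le_mul_of_nonneg_right (norm_one_div_sq_le hη hx) (norm_nonneg a)

lemma aestronglyMeasurable_div_w_sq {f : ℂ × ℂ → ℂ} {μ : Measure (ℂ × ℂ)}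
    (hf : AEStronglyMeasurable f μ) (z : ℂ × ℂ) :
    AEStronglyMeasurable (fun ξ => f ξ / (w m₁ m₂ ξ z) ^ 2) μ :=
  (hf.aemeasurable.div ((measurable_w m₁ m₂ z).pow_const 2).aemeasurable).aestronglyMeasurable

lemma integrable_div_w_sq (hm₁ : 0 < m₁) (hm₂ : 0 < m₂) {f : ℂ × ℂ → ℂ}
    (hf : Integrable f (lerayMeasure m₁ m₂)) {z : ℂ × ℂ} {η : ℝ} (hη : 0 < η)
    (hw : ∀ ξ ∈ bdry m₁ m₂, f ξ = 0 ∨ η ≤ ‖w m₁ m₂ ξ z‖) :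
    Integrable (fun ξ => f ξ / (w m₁ m₂ ξ z) ^ 2) (lerayMeasure m₁ m₂) := by
  refine (hf.norm.const_mul (1 / η ^ 2)).mono' (aestronglyMeasurable_div_w_sq hf.1 z) ?_
  filter_upwards [ae_mem_bdry hm₁ hm₂] with ξ hξ using norm_div_sq_le hη (hw ξ hξ)

lemma cauchyLF_add (hm₁ : 1 / 2 < m₁) (hm₂ : 1 / 2 < m₂) {f g : ℂ × ℂ → ℂ}
    (hf : Integrable f (lerayMeasure m₁ m₂)) (hg : Integrable g (lerayMeasure m₁ m₂))
    {z : ℂ × ℂ} (hz : rho m₁ m₂ z < 1) :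
    cauchyLF m₁ m₂ (fun ξ => f ξ + g ξ) z = cauchyLF m₁ m₂ f z + cauchyLF m₁ m₂ g z := by
  have hint {h : ℂ × ℂ → ℂ} (hh : Integrable h (lerayMeasure m₁ m₂)) :
      Integrable (fun ξ => h ξ / (w m₁ m₂ ξ z) ^ 2) (lerayMeasure m₁ m₂) :=
    integrable_div_w_sq (by linarith) (by linarith) hh (by linarith)
      fun ξ hξ => Or.inr (le_norm_w hm₁ hm₂ hξ z)
  rw [cauchyLF, cauchyLF, cauchyLF, ← mul_add, ← integral_add (hint hf) (hint hg)]
  simp only [add_div]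

lemma tendsto_cauchyLF_of_eventually_eq_zero (hm₁ : 1 ≤ m₁) (hm₂ : 1 ≤ m₂) {f : ℂ × ℂ → ℂ}
    (hf : Integrable f (lerayMeasure m₁ m₂)) {z : ℂ × ℂ} (hz : z ∈ bdry m₁ m₂)
    (hfz : ∀ᶠ ξ in 𝓝[bdry m₁ m₂] z, f ξ = 0) :
    Tendsto (fun r : ℝ => cauchyLF m₁ m₂ f (r • z)) (𝓝[<] 1) (𝓝 (cauchyLF m₁ m₂ f z)) := by
  have hbdry := ae_mem_bdry (m₁ := m₁) (m₂ := m₂) (by linarith) (by linarith)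
  obtain ⟨η, hη, hw⟩ := exists_eq_zero_or_le_norm_w hm₁ hm₂ hz hfz
  refine Tendsto.const_mul _ (tendsto_integral_filter_of_dominated_convergence
    (fun ξ => 1 / η ^ 2 * ‖f ξ‖)
    (Eventually.of_forall fun r => aestronglyMeasurable_div_w_sq hf.1 _) ?_
    (hf.norm.const_mul _) ?_)
  · filter_upwards [Ioo_mem_nhdsLT zero_lt_one] with r hr
    filter_upwards [hbdry] with ξ hξ
    exact norm_div_sq_le hη (hw ξ hξ r (Ioo_subset_Icc_self hr))
  · filter_upwards [hbdry] with ξ hξ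
    have hcont : Continuous fun r : ℝ => w m₁ m₂ ξ (r • z) :=
      continuous_w_comp hm₁ hm₂ continuous_const (by fun_prop)
    have hlim := (hcont.tendsto 1).mono_left (nhdsWithin_le_nhds (s := Iio 1))
    have hξ₁ := hw ξ hξ 1 (right_mem_Icc.2 zero_le_one)
    rw [one_smul] at hlim hξ₁
    rcases hξ₁ with h0 | hle
    · simp [h0]
    · exact tendsto_const_nhds.div (hlim.pow 2) (pow_ne_zero 2 (norm_pos_iff.1 (hη.trans_le hle)))

lemma exists_tendsto_cauchyLF_of_eventually_eq (hm₁ : 1 ≤ m₁) (hm₂ : 1 ≤ m₂) {f : ℂ × ℂ → ℂ}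
    (hf : Integrable f (lerayMeasure m₁ m₂)) {z : ℂ × ℂ} (hz : z ∈ bdry m₁ m₂) {c : ℂ}
    (hfz : ∀ᶠ ξ in 𝓝[bdry m₁ m₂] z, f ξ = c) :
    ∃ y, Tendsto (fun r : ℝ => cauchyLF m₁ m₂ f (r • z)) (𝓝[<] 1) (𝓝 y) := by
  have := isFiniteMeasure_lerayMeasure (m₁ := m₁) (m₂ := m₂) (by linarith) (by linarith)
  have hconst : Integrable (fun _ => c) (lerayMeasure m₁ m₂) := integrable_const c
  have hlim := tendsto_cauchyLF_of_eventually_eq_zero hm₁ hm₂ (hf.sub hconst) hz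
    (hfz.mono fun ξ hξ => by simp only [Pi.sub_apply, hξ, sub_self])
  refine ⟨_, (hlim.add_const (cauchyLF m₁ m₂ (fun _ => c) 0)).congr' ?_⟩
  filter_upwards [Ioo_mem_nhdsLT zero_lt_one] with r hr
  have hlt : rho m₁ m₂ (r • z) < 1 :=
    (rho_smul_le_of_mem_bdry (by linarith) (by linarith) hz (Ioo_subset_Icc_self hr)).trans_lt hr.2
  rw [← cauchyLF_const (by linarith) (by linarith) c hlt,
    ← cauchyLF_add (by linarith) (by linarith) (hf.sub hconst) hconst hlt]
  simp only [Pi.sub_apply, sub_add_cancel]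

end RadialLimits

section Kernel

variable {m : ℝ}

lemma star_mul_eq_polar (ξ z : ℂ) :
    star ξ * z = ((‖ξ‖ * ‖z‖ : ℝ) : ℂ) * Complex.exp (((z.arg - ξ.arg : ℝ) : ℂ) * Complex.I) := by
  have hexp : Complex.exp (((z.arg - ξ.arg : ℝ) : ℂ) * Complex.I)
      = Complex.exp ((starRingEnd ℂ) (ξ.arg * Complex.I)) * Complex.exp (z.arg * Complex.I) := by
    rw [← Complex.exp_add, map_mul, Complex.conj_ofReal, Complex.conj_I, Complex.ofReal_sub]
    ring_nf
  nth_rewrite 1 [← Complex.norm_mul_exp_arg_mul_I ξ, ← Complex.norm_mul_exp_arg_mul_I z]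
  rw [star_mul', Complex.star_def, Complex.conj_ofReal, ← Complex.exp_conj, hexp]
  push_cast
  ring

lemma star_mul_re (ξ z : ℂ) : (star ξ * z).re = ‖ξ‖ * ‖z‖ * cos (z.arg - ξ.arg) := by
  rw [star_mul_eq_polar, Complex.re_ofReal_mul, Complex.exp_ofReal_mul_I_re]

lemma star_mul_im (ξ z : ℂ) : (star ξ * z).im = ‖ξ‖ * ‖z‖ * sin (z.arg - ξ.arg) := by
  rw [star_mul_eq_polar, Complex.im_ofReal_mul, Complex.exp_ofReal_mul_I_im]

lemma norm_wCoord_le (hm : 1 / 2 < m) (ξ z : ℂ) :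
    ‖wCoord m ξ z‖ ≤ 2 * m * ‖ξ‖ ^ (2 * m) + ‖z‖ ^ (2 * m) / 2 := by
  have hm0 : 0 < m := by linarith
  have hnonneg : 0 ≤ ‖ξ‖ ^ (2 * m) := by positivity
  rw [wCoord_eq_sub hm0.ne']
  refine (norm_sub_le _ _).trans ?_
  rw [norm_mul, norm_mul, norm_star, Complex.norm_real, Complex.norm_real,
    norm_of_nonneg (by positivity), norm_of_nonneg (by positivity)]
  linarith [mul_rpow_mul_le hm (norm_nonneg ξ) (norm_nonneg z)]

lemma rpow_mul_rpow_le {a b : ℝ} (hm : 1 / 2 ≤ m) (ha : a ∈ Icc (0 : ℝ) 1)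
    (hb : b ∈ Icc (0 : ℝ) 1) : a ^ (2 * m) * b ^ (2 * m) ≤ a ^ (2 * (m - 1)) * (a * b) := by
  have hbb : b ^ (2 * m) ≤ b := rpow_le_self_of_le_one hb.1 hb.2 (by linarith)
  have haa : a ^ 2 ≤ a := pow_le_of_le_one ha.1 ha.2 two_ne_zero
  have ha0 := rpow_nonneg ha.1 (2 * (m - 1))
  rw [← rpow_two_mul_sub_one_mul_sq (by linarith) ha.1, mul_assoc]
  exact mul_le_mul_of_nonneg_left
    (mul_le_mul haa hbb (rpow_nonneg hb.1 _) ha.1) ha0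

lemma rpow_mul_mul_le_one {a b : ℝ} (hm : 1 ≤ m) (ha : a ∈ Icc (0 : ℝ) 1)
    (hb : b ∈ Icc (0 : ℝ) 1) : a ^ (2 * (m - 1)) * (a * b) ≤ 1 :=
  mul_le_one₀ (rpow_le_one ha.1 ha.2 (by linarith)) (mul_nonneg ha.1 hb.1)
    (mul_le_one₀ ha.2 hb.1 hb.2)

lemma wCoord_re_polar (hm : m ≠ 0) (ξ z : ℂ) : (wCoord m ξ z).re
    = m * (‖ξ‖ ^ (2 * m) - ‖ξ‖ ^ (2 * (m - 1)) * (‖ξ‖ * ‖z‖) * cos (z.arg - ξ.arg)) := by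
  rw [wCoord_re hm, star_mul_re]
  ring

lemma wCoord_im_polar (hm : m ≠ 0) (ξ z : ℂ) : (wCoord m ξ z).im
    = -(m * (‖ξ‖ ^ (2 * (m - 1)) * (‖ξ‖ * ‖z‖) * sin (z.arg - ξ.arg))) := by
  rw [wCoord_im hm, star_mul_im]
  ring

section UnitDisc

variable {ξ z : ℂ}

lemma wCoord_re_le (hm : 1 ≤ m) (hξ : ‖ξ‖ ≤ 1) (hz : ‖z‖ ≤ 1) :
    (wCoord m ξ z).re ≤ m * (1 - ‖z‖ ^ (2 * m) + (z.arg - ξ.arg) ^ 2 / 2) := by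
  have hlower := rpow_mul_rpow_le (m := m) (by linarith) ⟨norm_nonneg ξ, hξ⟩ ⟨norm_nonneg z, hz⟩
  have hupper := rpow_mul_mul_le_one hm ⟨norm_nonneg ξ, hξ⟩ ⟨norm_nonneg z, hz⟩
  have hξ1 : ‖ξ‖ ^ (2 * m) ≤ 1 := rpow_le_one (norm_nonneg ξ) hξ (by linarith)
  have hz1 : ‖z‖ ^ (2 * m) ≤ 1 := rpow_le_one (norm_nonneg z) hz (by linarith)
  have hkernel : 0 ≤ ‖ξ‖ ^ (2 * (m - 1)) * (‖ξ‖ * ‖z‖) := by positivity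
  rw [wCoord_re_polar (by linarith)]
  generalize ‖ξ‖ ^ (2 * (m - 1)) * (‖ξ‖ * ‖z‖) = k at *
  refine mul_le_mul_of_nonneg_left ?_ (by linarith)
  have hcos := mul_le_mul_of_nonneg_left (one_sub_sq_div_two_le_cos (x := z.arg - ξ.arg)) hkernel
  have hsq := mul_le_mul_of_nonneg_right hupper
    (by positivity : 0 ≤ (z.arg - ξ.arg) ^ 2 / 2)
  have hprod := mul_le_mul_of_nonneg_right hξ1 (sub_nonneg.2 hz1)
  linarith

lemma neg_wCoord_im_le (hm : 1 ≤ m) (hξ : ‖ξ‖ ≤ 1) (hz : ‖z‖ ≤ 1) (harg : ξ.arg ≤ z.arg) :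
    -(wCoord m ξ z).im ≤ m * (z.arg - ξ.arg) := by
  have hupper := rpow_mul_mul_le_one hm ⟨norm_nonneg ξ, hξ⟩ ⟨norm_nonneg z, hz⟩
  rw [wCoord_im_polar (by linarith), neg_neg]
  refine mul_le_mul_of_nonneg_left ?_ (by linarith)
  calc _ ≤ ‖ξ‖ ^ (2 * (m - 1)) * (‖ξ‖ * ‖z‖) * (z.arg - ξ.arg) := by
        gcongr
        exact sin_le (sub_nonneg.2 harg)
    _ ≤ z.arg - ξ.arg := mul_le_of_le_one_left (sub_nonneg.2 harg) hupper

lemma le_neg_wCoord_im (hm : 1 / 2 ≤ m) (hξ : ‖ξ‖ ≤ 1) (hz : ‖z‖ ≤ 1)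
    (harg : z.arg - ξ.arg ∈ Icc 0 (π / 2)) :
    m * (‖ξ‖ ^ (2 * m) * ‖z‖ ^ (2 * m) * (2 / π * (z.arg - ξ.arg))) ≤ -(wCoord m ξ z).im := by
  have hlower := rpow_mul_rpow_le hm ⟨norm_nonneg ξ, hξ⟩ ⟨norm_nonneg z, hz⟩
  rw [wCoord_im_polar (by linarith), neg_neg]
  have harg0 := harg.1
  gcongr
  exact mul_le_sin harg.1 harg.2

variable {s : ℝ}

lemma abs_wCoord_re_le (hm : 1 ≤ m) (hξ : ‖ξ‖ ≤ 1) (hz : ‖z‖ ≤ 1) (hs : s ≤ 1 / 100)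
    (harg : z.arg - ξ.arg ∈ Icc s (2 * s)) (hξs : 1 - ‖ξ‖ ^ (2 * m) ≤ s / 100)
    (hzs : 1 - ‖z‖ ^ (2 * m) ≤ s / 100) : |(wCoord m ξ z).re| ≤ 3 / 100 * (m * s) := by
  have hs0 : 0 ≤ s := by linarith [harg.1, harg.2]
  have hz1 : ‖z‖ ^ (2 * m) ≤ 1 := rpow_le_one (norm_nonneg z) hz (by linarith)
  have hsq : (z.arg - ξ.arg) ^ 2 ≤ 4 / 100 * s := by
    calc (z.arg - ξ.arg) ^ 2 ≤ (2 * s) ^ 2 := pow_le_pow_left₀ (hs0.trans harg.1) harg.2 2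
      _ = 4 * s * s := by ring
      _ ≤ 4 * s * (1 / 100) := by gcongr
      _ = 4 / 100 * s := by ring
  have hupper : m * (1 - ‖z‖ ^ (2 * m) + (z.arg - ξ.arg) ^ 2 / 2) ≤ m * (3 / 100 * s) :=
    mul_le_mul_of_nonneg_left (by linarith) (by linarith)
  refine abs_le.2 ⟨?_, by linarith [wCoord_re_le hm hξ hz]⟩
  linarith [le_wCoord_re (by linarith : 1 / 2 < m) ξ z, le_mul_of_one_le_left hs0 hm]

lemma neg_wCoord_im_mem_Icc (hm : 1 ≤ m) (hξ : ‖ξ‖ ≤ 1) (hz : ‖z‖ ≤ 1) (hs : s ≤ 1 / 100)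
    (harg : z.arg - ξ.arg ∈ Icc s (2 * s)) (hξs : 1 - ‖ξ‖ ^ (2 * m) ≤ s / 100)
    (hzs : 1 - ‖z‖ ^ (2 * m) ≤ s / 100) :
    -(wCoord m ξ z).im ∈ Icc (1 / 2 * (m * s)) (2 * (m * s)) := by
  have hs0 : 0 ≤ s := by linarith [harg.1, harg.2]
  have hm0 : 0 ≤ m := by linarith
  have hπ : 6 / 10 ≤ 2 / π := by
    rw [le_div_iff₀ pi_pos]
    linarith [pi_lt_d2]
  have hpow : 99 / 100 * (99 / 100) ≤ ‖ξ‖ ^ (2 * m) * ‖z‖ ^ (2 * m) :=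
    mul_le_mul (by linarith) (by linarith) (by norm_num) (by positivity)
  constructor
  · calc 1 / 2 * (m * s) ≤ m * (99 / 100 * (99 / 100) * (6 / 10 * s)) := by
          linarith [mul_nonneg hm0 hs0]
      _ ≤ m * (‖ξ‖ ^ (2 * m) * ‖z‖ ^ (2 * m) * (2 / π * (z.arg - ξ.arg))) := by
          gcongr
          exact harg.1
      _ ≤ -(wCoord m ξ z).im := le_neg_wCoord_im (by linarith) hξ hz
          ⟨hs0.trans harg.1, by linarith [harg.2, pi_gt_three]⟩
  · calc -(wCoord m ξ z).im ≤ m * (z.arg - ξ.arg) :=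
          neg_wCoord_im_le hm hξ hz (by linarith [harg.1])
      _ ≤ m * (2 * s) := mul_le_mul_of_nonneg_left harg.2 hm0
      _ = 2 * (m * s) := by ring

end UnitDisc

lemma one_sub_norm_snd_rpow {m₁ m₂ : ℝ} {ξ : ℂ × ℂ} (hξ : ξ ∈ bdry m₁ m₂) :
    1 - ‖ξ.2‖ ^ (2 * m₂) = ‖ξ.1‖ ^ (2 * m₁) :=
  sub_eq_of_eq_add (Eq.symm hξ)

-- When `arg ξ.2 < arg z.2` and `ξ.1`, `z.1` are small compared with the gap between the arguments,
-- `w ξ z` is close to the negative imaginary axis, so `1 / w ξ z ^ 2` is nearly negative.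
lemma w_bounds {m₁ m₂ s : ℝ} {ξ z : ℂ × ℂ} (hm₁ : 1 ≤ m₁) (hm₂ : 1 ≤ m₂) (hs : s ≤ 1 / 100)
    (hξ : ξ ∈ bdry m₁ m₂) (hz : z ∈ bdry m₁ m₂) (harg : z.2.arg - ξ.2.arg ∈ Icc s (2 * s))
    (hfst : m₁ * (‖ξ.1‖ ^ (2 * m₁) + ‖z.1‖ ^ (2 * m₁)) ≤ s / 100) :
    |(w m₁ m₂ ξ z).re| ≤ 6 / 100 * (m₂ * s) ∧
      -(w m₁ m₂ ξ z).im ∈ Icc (4 / 10 * (m₂ * s)) (3 * (m₂ * s)) := by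
  have hξ2 := norm_le_one_of_rpow_le_one (by linarith) (norm_snd_rpow_le_one hξ)
  have hz2 := norm_le_one_of_rpow_le_one (by linarith) (norm_snd_rpow_le_one hz)
  have hξ1 : 0 ≤ ‖ξ.1‖ ^ (2 * m₁) := by positivity
  have hz1 : 0 ≤ ‖z.1‖ ^ (2 * m₁) := by positivity
  have hsum : ‖ξ.1‖ ^ (2 * m₁) + ‖z.1‖ ^ (2 * m₁) ≤ s / 100 :=
    (le_mul_of_one_le_left (add_nonneg hξ1 hz1) hm₁).trans hfst
  have hξs : 1 - ‖ξ.2‖ ^ (2 * m₂) ≤ s / 100 := by linarith [one_sub_norm_snd_rpow hξ]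
  have hzs : 1 - ‖z.2‖ ^ (2 * m₂) ≤ s / 100 := by linarith [one_sub_norm_snd_rpow hz]
  have hnorm : ‖wCoord m₁ ξ.1 z.1‖ ≤ 2 / 100 * (m₂ * s) := by
    have hs0 : 0 ≤ s := by linarith [harg.1, harg.2]
    linarith [norm_wCoord_le (by linarith : 1 / 2 < m₁) ξ.1 z.1, le_mul_of_one_le_left hs0 hm₂,
      le_mul_of_one_le_left hz1 hm₁]
  have hre := abs_wCoord_re_le hm₂ hξ2 hz2 hs harg hξs hzs
  have him := neg_wCoord_im_mem_Icc hm₂ hξ2 hz2 hs harg hξs hzs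
  have hre1 := (Complex.abs_re_le_norm _).trans hnorm
  have him1 := abs_le.1 ((Complex.abs_im_le_norm _).trans hnorm)
  have : 0 ≤ m₂ * s := by linarith [norm_nonneg (wCoord m₁ ξ.1 z.1)]
  rw [w_eq_wCoord_add, Complex.add_re, Complex.add_im]
  exact ⟨(abs_add_le _ _).trans (by linarith), by linarith [him.1, him1.2],
    by linarith [him.2, him1.1]⟩

lemma le_neg_one_div_sq_re {D : ℝ} {v : ℂ} (hD : 0 < D) (hre : |v.re| ≤ 6 / 100 * D)
    (him : -v.im ∈ Icc (4 / 10 * D) (3 * D)) : 1 / (1000 * D ^ 2) ≤ -(1 / v ^ 2).re := by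
  have hre_sq : v.re ^ 2 ≤ (6 / 100 * D) ^ 2 := sq_le_sq' (abs_le.1 hre).1 (abs_le.1 hre).2
  have him_sq_ge : (4 / 10 * D) ^ 2 ≤ (-v.im) ^ 2 := by gcongr; exact him.1
  have him_sq_le : (-v.im) ^ 2 ≤ (3 * D) ^ 2 :=
    pow_le_pow_left₀ (by linarith [him.1]) him.2 2
  rw [neg_sq] at him_sq_ge him_sq_le
  have hnormSq : Complex.normSq v = v.re ^ 2 + v.im ^ 2 := by rw [Complex.normSq_apply]; ring
  have hdiff : 15 / 100 * D ^ 2 ≤ v.im ^ 2 - v.re ^ 2 := by linarith [sq_nonneg D]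
  have hle : Complex.normSq v ≤ 10 * D ^ 2 := by linarith [sq_nonneg D]
  have hpos : 0 < Complex.normSq v := by
    linarith [sq_nonneg v.re, sq_pos_of_pos hD]
  have heq : -(1 / v ^ 2).re = (v.im ^ 2 - v.re ^ 2) / Complex.normSq v ^ 2 := by
    rw [one_div, Complex.inv_re, map_pow, sq v, Complex.mul_re]
    ring
  rw [heq]
  calc 1 / (1000 * D ^ 2) ≤ 15 / 100 * D ^ 2 / (10 * D ^ 2) ^ 2 := by
        rw [div_le_div_iff₀ (by positivity) (by positivity)]
        linarith [sq_nonneg (D ^ 2)]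
    _ ≤ (v.im ^ 2 - v.re ^ 2) / Complex.normSq v ^ 2 :=
        div_le_div₀ (by linarith [sq_nonneg D]) hdiff (by positivity) (by gcongr)

lemma le_neg_one_div_w_sq_re {m₁ m₂ s : ℝ} {ξ z : ℂ × ℂ} (hm₁ : 1 ≤ m₁) (hm₂ : 1 ≤ m₂)
    (hs0 : 0 < s) (hs : s ≤ 1 / 100) (hξ : ξ ∈ bdry m₁ m₂) (hz : z ∈ bdry m₁ m₂)
    (harg : z.2.arg - ξ.2.arg ∈ Icc s (2 * s))
    (hfst : m₁ * (‖ξ.1‖ ^ (2 * m₁) + ‖z.1‖ ^ (2 * m₁)) ≤ s / 100) :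
    1 / (1000 * (m₂ * s) ^ 2) ≤ -(1 / w m₁ m₂ ξ z ^ 2).re :=
  have hw := w_bounds hm₁ hm₂ hs hξ hz harg hfst
  le_neg_one_div_sq_re (by positivity) hw.1 hw.2

end Kernel

section Halving

/-- A positive sequence that is at least halved at each step, so that the arcs `[-2 a k, -a k]`
of the patches `W_{a k}` overlap in at most an endpoint. -/
structure IsHalving (a : ℕ → ℝ) : Prop where
  pos : ∀ k, 0 < a k
  two_mul_succ_le : ∀ k, 2 * a (k + 1) ≤ a k

variable {a : ℕ → ℝ}

lemma Admissible.isHalving {p₀ α₀ : ℝ} {ψ : ℝ → ℝ} (h : Admissible p₀ ψ α₀ a) : IsHalving a :=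
  ⟨h.pos, h.halving⟩

lemma IsHalving.antitone (h : IsHalving a) : Antitone a :=
  antitone_nat_of_succ_le fun n => by linarith [h.two_mul_succ_le n, h.pos (n + 1)]

lemma IsHalving.two_mul_le_of_lt (h : IsHalving a) {j k : ℕ} (hjk : j < k) : 2 * a k ≤ a j := by
  linarith [h.two_mul_succ_le j, h.antitone (Nat.succ_le_of_lt hjk)]

lemma IsHalving.tendsto_zero (h : IsHalving a) : Tendsto a atTop (𝓝 0) := by
  have hle : ∀ k, a k ≤ (1 / 2) ^ k * a 0 := by
    intro k
    induction k with
    | zero => simp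
    | succ k ih => rw [pow_succ]; linarith [h.two_mul_succ_le k]
  have hgeom := (tendsto_pow_atTop_nhds_zero_of_lt_one (r := (1 / 2 : ℝ)) (by norm_num)
    (by norm_num)).mul_const (a 0)
  rw [zero_mul] at hgeom
  exact squeeze_zero (fun k => (h.pos k).le) hle hgeom

end Halving

section TestFunction

variable {m₁ m₂ γ₁ γ₂ p₀ : ℝ} {ψ : ℝ → ℝ} {a : ℕ → ℝ}

lemma patch_eq_box (m₁ m₂ γ₁ γ₂ α : ℝ) : patch m₁ m₂ γ₁ γ₂ α
    = box m₁ m₂ (Icc (-(π / 12)) 0) (Icc (-2 * α) (-α)) (Icc (γ₁ * α) (γ₂ * α)) := rfl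

lemma measurableSet_patch (m₁ m₂ γ₁ γ₂ α : ℝ) : MeasurableSet (patch m₁ m₂ γ₁ γ₂ α) := by
  rw [patch_eq_box]
  exact measurableSet_box _ _ measurableSet_Icc measurableSet_Icc measurableSet_Icc

lemma measurable_testFun : Measurable (testFun m₁ m₂ γ₁ γ₂ p₀ ψ a) :=
  Measurable.tsum fun _ => measurable_const.indicator (measurableSet_patch ..)

variable {ξ : ℂ × ℂ}

lemma eq_of_mem_patch (ha : IsHalving a) (hξ : ∀ k, ξ.2.arg ≠ -a k) {j k : ℕ}
    (hj : ξ ∈ patch m₁ m₂ γ₁ γ₂ (a j)) (hk : ξ ∈ patch m₁ m₂ γ₁ γ₂ (a k)) : j = k := by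
  have not_lt : ∀ {i l : ℕ}, ξ ∈ patch m₁ m₂ γ₁ γ₂ (a i) → ξ ∈ patch m₁ m₂ γ₁ γ₂ (a l) →
      ¬i < l := fun {i l} hi hl hil => by
    linarith [ha.two_mul_le_of_lt hil, lt_of_le_of_ne hi.2.2.1.2 (hξ i), hl.2.2.1.1]
  exact le_antisymm (le_of_not_gt (not_lt hk hj)) (le_of_not_gt (not_lt hj hk))

lemma testFun_of_mem (ha : IsHalving a) (hξ : ∀ k, ξ.2.arg ≠ -a k) {k : ℕ}
    (hk : ξ ∈ patch m₁ m₂ γ₁ γ₂ (a k)) :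
    testFun m₁ m₂ γ₁ γ₂ p₀ ψ a ξ = (coeff p₀ ψ (a k) : ℂ) := by
  rw [testFun, tsum_eq_single k fun j hj =>
    indicator_of_notMem (fun hmem => hj (eq_of_mem_patch ha hξ hmem hk)) _, indicator_of_mem hk]

lemma testFun_of_forall_notMem (hξ : ∀ k, ξ ∉ patch m₁ m₂ γ₁ γ₂ (a k)) :
    testFun m₁ m₂ γ₁ γ₂ p₀ ψ a ξ = 0 := by
  simp only [testFun, indicator_of_notMem (hξ _), tsum_zero]

lemma testFun_of_arg_pos (ha : ∀ k, 0 < a k) (hξ : 0 < ξ.2.arg) :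
    testFun m₁ m₂ γ₁ γ₂ p₀ ψ a ξ = 0 :=
  testFun_of_forall_notMem fun k hk => by linarith [hk.2.2.1.2, ha k]

lemma testFun_eq_sum_range (ha : ∀ k, 0 < a k) {N : ℕ} (hN : ∀ k ≥ N, 2 * a k < |ξ.2.arg|) :
    testFun m₁ m₂ γ₁ γ₂ p₀ ψ a ξ = ∑ k ∈ Finset.range N,
      (patch m₁ m₂ γ₁ γ₂ (a k)).indicator (fun _ => (coeff p₀ ψ (a k) : ℂ)) ξ := by
  refine tsum_eq_sum fun k hk => indicator_of_notMem (fun hmem => ?_) _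
  have hle : |ξ.2.arg| ≤ 2 * a k :=
    abs_le.2 ⟨by linarith [hmem.2.2.1.1], by linarith [hmem.2.2.1.2, ha k]⟩
  exact (hN k (by simpa using hk)).not_ge hle

end TestFunction

section ImageOfTestFunction

lemma eventually_mem_Icc_iff {X : Type*} {l : Filter X} {u : X → ℝ} {x c d : ℝ}
    (hu : Tendsto u l (𝓝 x)) (hc : x ≠ c) (hd : x ≠ d) :
    ∀ᶠ y in l, (u y ∈ Icc c d ↔ x ∈ Icc c d) := by
  by_cases hx : x ∈ Icc c d
  · have hcd := Icc_mem_nhds (lt_of_le_of_ne hx.1 hc.symm) (lt_of_le_of_ne hx.2 hd)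
    filter_upwards [hu hcd] with y hy using iff_of_true hy hx
  · filter_upwards [hu (isClosed_Icc.isOpen_compl.mem_nhds hx)] with y hy using iff_of_false hy hx

lemma continuousAt_arg_of_arg_ne {x : ℂ} (h0 : x.arg ≠ 0) (hπ : x.arg ≠ π) :
    ContinuousAt Complex.arg x :=
  Complex.continuousAt_arg <| Complex.mem_slitPlane_iff_arg.2
    ⟨hπ, fun hx => h0 (by rw [hx, Complex.arg_zero])⟩

/-- The values of `arg ξ.1`, `arg ξ.2` and `‖ξ.1‖ ^ (2 * m₁)` at which the arguments may be
discontinuous or membership in the patch `W_α` may change. -/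
def exceptional (γ₁ γ₂ α : ℝ) : Set ℝ := {0, π, -(π / 12), -2 * α, -α, γ₁ * α, γ₂ * α}

variable {m₁ m₂ γ₁ γ₂ p₀ : ℝ} {ψ : ℝ → ℝ} {a : ℕ → ℝ} {z : ℂ × ℂ}

lemma eventually_mem_patch_iff {α : ℝ} (hm₁ : 0 ≤ m₁)
    (hz : z ∈ box m₁ m₂ (exceptional γ₁ γ₂ α)ᶜ (exceptional γ₁ γ₂ α)ᶜ (exceptional γ₁ γ₂ α)ᶜ) :
    ∀ᶠ ξ in 𝓝[bdry m₁ m₂] z, (ξ ∈ patch m₁ m₂ γ₁ γ₂ α ↔ z ∈ patch m₁ m₂ γ₁ γ₂ α) := by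
  obtain ⟨hzb, h1, h2, h3⟩ := hz
  simp only [exceptional, mem_compl_iff, mem_insert_iff, mem_singleton_iff, not_or] at h1 h2 h3
  have hid : Tendsto (fun ξ : ℂ × ℂ => ξ) (𝓝[bdry m₁ m₂] z) (𝓝 z) := nhdsWithin_le_nhds
  have harg1 := (continuousAt_arg_of_arg_ne h1.1 h1.2.1).tendsto.comp
    ((continuous_fst.tendsto z).comp hid)
  have harg2 := (continuousAt_arg_of_arg_ne h2.1 h2.2.1).tendsto.comp
    ((continuous_snd.tendsto z).comp hid)
  have hradius : Continuous fun ξ : ℂ × ℂ => ‖ξ.1‖ ^ (2 * m₁) :=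
    continuous_fst.norm.rpow_const fun _ => Or.inr (by linarith)
  filter_upwards [eventually_mem_Icc_iff harg1 h1.2.2.1 h1.1,
    eventually_mem_Icc_iff harg2 h2.2.2.2.1 h2.2.2.2.2.1,
    eventually_mem_Icc_iff ((hradius.tendsto z).comp hid) h3.2.2.2.2.2.1 h3.2.2.2.2.2.2,
    self_mem_nhdsWithin] with ξ i1 i2 i3 hξb
  exact and_congr (iff_of_true hξb hzb) (and_congr i1 (and_congr i2 i3))

lemma eventually_testFun_eq (hm₁ : 0 ≤ m₁) (ha : IsHalving a)
    (hz : ∀ k, z ∈ box m₁ m₂ (exceptional γ₁ γ₂ (a k))ᶜ (exceptional γ₁ γ₂ (a k))ᶜ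
      (exceptional γ₁ γ₂ (a k))ᶜ) :
    ∀ᶠ ξ in 𝓝[bdry m₁ m₂] z,
      testFun m₁ m₂ γ₁ γ₂ p₀ ψ a ξ = testFun m₁ m₂ γ₁ γ₂ p₀ ψ a z := by
  have hz2 := (hz 0).2.2.1
  simp only [exceptional, mem_compl_iff, mem_insert_iff, not_or] at hz2
  have harg : Tendsto (fun ξ : ℂ × ℂ => |ξ.2.arg|) (𝓝[bdry m₁ m₂] z) (𝓝 |z.2.arg|) :=
    ((continuousAt_arg_of_arg_ne hz2.1 hz2.2.1).tendsto.comp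
      (continuous_snd.continuousWithinAt (x := z))).abs
  have hhalf : |z.2.arg| / 2 < |z.2.arg| := half_lt_self (abs_pos.2 hz2.1)
  obtain ⟨N, hN⟩ := (ha.tendsto_zero.eventually
    (gt_mem_nhds (half_pos (half_pos (abs_pos.2 hz2.1))))).exists_forall_of_atTop
  have hpatches : ∀ᶠ ξ in 𝓝[bdry m₁ m₂] z, ∀ k ∈ Finset.range N,
      (ξ ∈ patch m₁ m₂ γ₁ γ₂ (a k) ↔ z ∈ patch m₁ m₂ γ₁ γ₂ (a k)) :=
    (Finset.eventually_all _).2 fun k _ => eventually_mem_patch_iff hm₁ (hz k)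
  filter_upwards [harg.eventually (lt_mem_nhds hhalf), hpatches] with ξ hξ hmem
  rw [testFun_eq_sum_range ha.pos (N := N) fun k hk => by linarith [hN k hk],
    testFun_eq_sum_range ha.pos (N := N) fun k hk => by linarith [hN k hk]]
  exact Finset.sum_congr rfl fun k hk => indicator_eq_indicator (hmem k hk) rfl

lemma ae_forall_mem_box_exceptional (hm₁ : 0 < m₁) (hm₂ : 0 < m₂) (γ₁ γ₂ : ℝ) (a : ℕ → ℝ) :
    ∀ᵐ z ∂(lerayMeasure m₁ m₂), ∀ k, z ∈ box m₁ m₂ (exceptional γ₁ γ₂ (a k))ᶜ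
      (exceptional γ₁ γ₂ (a k))ᶜ (exceptional γ₁ γ₂ (a k))ᶜ := by
  refine ae_all_iff.2 fun _ => ae_mem_box_compl_of_countable hm₁ hm₂ ?_
  unfold exceptional
  exact (Set.toFinite _).countable

lemma exists_isImage_testFun (hm₁ : 1 ≤ m₁) (hm₂ : 1 ≤ m₂) (ha : IsHalving a)
    (hint : Integrable (testFun m₁ m₂ γ₁ γ₂ p₀ ψ a) (lerayMeasure m₁ m₂)) :
    ∃ g, IsImage m₁ m₂ (testFun m₁ m₂ γ₁ γ₂ p₀ ψ a) g := by
  have hlim : ∀ᵐ z ∂(lerayMeasure m₁ m₂), ∃ y, Tendsto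
      (fun r : ℝ => cauchyLF m₁ m₂ (testFun m₁ m₂ γ₁ γ₂ p₀ ψ a) (r • z)) (𝓝[<] 1) (𝓝 y) := by
    filter_upwards [ae_forall_mem_box_exceptional (by linarith) (by linarith) γ₁ γ₂ a] with z hz
    exact exists_tendsto_cauchyLF_of_eventually_eq hm₁ hm₂ hint (hz 0).1
      (eventually_testFun_eq (by linarith) ha hz)
  refine ⟨fun z => limUnder (𝓝[<] 1) fun r : ℝ =>
    cauchyLF m₁ m₂ (testFun m₁ m₂ γ₁ γ₂ p₀ ψ a) (r • z), ?_⟩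
  filter_upwards [hlim] with z hz using tendsto_nhds_limUnder hz

end ImageOfTestFunction

section PatchMeasure

variable {m₁ m₂ γ₁ γ₂ α : ℝ}

/-- The patch facing `W_α` across `θ₂ = 0`, with `θ₁` arbitrary: there the image of the test
function is large. -/
def oppositePatch (m₁ m₂ γ₁ γ₂ α : ℝ) : Set (ℂ × ℂ) :=
  box m₁ m₂ (Ioc (-π) π) (Ioo α (2 * α)) (Icc (γ₁ * α) (γ₂ * α))

lemma measurableSet_oppositePatch (m₁ m₂ γ₁ γ₂ α : ℝ) :
    MeasurableSet (oppositePatch m₁ m₂ γ₁ γ₂ α) :=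
  measurableSet_box _ _ measurableSet_Ioc measurableSet_Ioo measurableSet_Icc

lemma lerayMeasure_patch (hm₁ : 0 < m₁) (hm₂ : 0 < m₂) (hγ₁ : 0 < γ₁) (hγ : γ₁ ≤ γ₂) (hα : 0 < α)
    (hαπ : 2 * α < π) (hγα : γ₂ * α < 1) : lerayMeasure m₁ m₂ (patch m₁ m₂ γ₁ γ₂ α)
      = ENNReal.ofReal (m₁ * m₂ * (γ₂ - γ₁) * (π / 12) * α ^ 2) := by
  have hsub : 0 ≤ γ₂ * α - γ₁ * α := by rw [← sub_mul]; exact mul_nonneg (by linarith) hα.le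
  rw [patch_eq_box, lerayMeasure_box hm₁ hm₂ measurableSet_Icc measurableSet_Icc
    (fun x hx => ⟨by linarith [hx.1, pi_pos], by linarith [hx.2, pi_pos]⟩)
    (fun x hx => ⟨by linarith [hx.1], by linarith [hx.2, pi_pos]⟩) (by positivity)
    (by gcongr) hγα, Real.volume_Icc, Real.volume_Icc, ← ENNReal.ofReal_mul (by linarith [pi_pos]),
    ← ENNReal.ofReal_mul (by positivity)]
  congr 1
  ring

lemma lerayMeasure_oppositePatch (hm₁ : 0 < m₁) (hm₂ : 0 < m₂) (hγ₁ : 0 < γ₁) (hγ : γ₁ ≤ γ₂)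
    (hα : 0 < α) (hαπ : 2 * α ≤ π) (hγα : γ₂ * α < 1) :
    lerayMeasure m₁ m₂ (oppositePatch m₁ m₂ γ₁ γ₂ α)
      = ENNReal.ofReal (m₁ * m₂ * (γ₂ - γ₁) * (2 * π) * α ^ 2) := by
  have hsub : 0 ≤ γ₂ * α - γ₁ * α := by rw [← sub_mul]; exact mul_nonneg (by linarith) hα.le
  rw [oppositePatch, lerayMeasure_box hm₁ hm₂ measurableSet_Ioc measurableSet_Ioo Subset.rfl
    (fun x hx => ⟨by linarith [hx.1, pi_pos], by linarith [hx.2]⟩) (by positivity)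
    (by gcongr) hγα, Real.volume_Ioc, Real.volume_Ioo, ← ENNReal.ofReal_mul (by linarith [pi_pos]),
    ← ENNReal.ofReal_mul (by positivity)]
  congr 1
  ring

lemma pairwise_disjoint_oppositePatch {a : ℕ → ℝ} (ha : IsHalving a) :
    Pairwise (Function.onFun Disjoint fun k => oppositePatch m₁ m₂ γ₁ γ₂ (a k)) := by
  refine (pairwise_disjoint_on _).2 fun j k hjk => disjoint_left.2 fun ξ hj hk => ?_
  linarith [hj.2.2.1.1, hk.2.2.1.2, ha.two_mul_le_of_lt hjk]

end PatchMeasure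

section Coefficient

variable {p₀ α : ℝ} {ψ : ℝ → ℝ}

lemma one_le_coeff (hα : 0 < α) (hα1 : α ≤ 1) (hp : 0 ≤ p₀ + ψ α) : 1 ≤ coeff p₀ ψ α :=
  one_le_rpow_of_pos_of_le_one_of_nonpos hα hα1 (div_nonpos_of_nonpos_of_nonneg (by norm_num) hp)

lemma coeff_rpow (hα : 0 ≤ α) (hp : p₀ + ψ α ≠ 0) :
    coeff p₀ ψ α ^ (p₀ + ψ α) = (α ^ 2)⁻¹ := by
  rw [coeff, ← rpow_mul hα, div_mul_cancel₀ _ hp, rpow_neg hα]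
  norm_cast

lemma coeff_rpow_mul_sq (hα : 0 < α) (hp₀ : p₀ ≠ 0) :
    coeff p₀ ψ α ^ p₀ * α ^ 2 = ((1 / α) ^ (1 / (p₀ + ψ α) - 1 / p₀)) ^ (2 * p₀) := by
  rw [coeff, ← rpow_natCast α 2, ← rpow_mul hα.le, ← rpow_add hα, one_div, inv_rpow hα.le,
    ← rpow_neg hα.le, ← rpow_mul hα.le]
  congr 1
  push_cast
  field_simp
  ring

lemma two_rpow_neg_div_rpow (hp₀ : p₀ ≠ 0) (k : ℕ) :
    ((2 : ℝ) ^ (-((k : ℝ) + 1) / p₀)) ^ (2 * p₀) = (1 / 4) ^ (k + 1) := by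
  have hexp : -((k : ℝ) + 1) / p₀ * (2 * p₀) = (-2) * ((k + 1 : ℕ) : ℝ) := by
    push_cast
    field_simp
  rw [← rpow_mul (by norm_num), hexp, rpow_mul (by norm_num), rpow_natCast,
    rpow_neg (by norm_num)]
  norm_num

lemma Admissible.coeff_rpow_mul_sq_le {α₀ : ℝ} {a : ℕ → ℝ} (ha : Admissible p₀ ψ α₀ a)
    (hp₀ : 0 < p₀) (k : ℕ) : coeff p₀ ψ (a k) ^ p₀ * a k ^ 2 ≤ (1 / 4) ^ (k + 1) := by
  have hpos := ha.pos k
  rw [coeff_rpow_mul_sq hpos hp₀.ne', ← two_rpow_neg_div_rpow hp₀.ne']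
  gcongr
  exact ha.decay k

end Coefficient

section Membership

variable {m₁ m₂ γ₁ γ₂ p₀ α₀ : ℝ} {ψ : ℝ → ℝ} {a : ℕ → ℝ}

lemma ae_arg_snd_ne_neg (hm₁ : 0 < m₁) (hm₂ : 0 < m₂) (a : ℕ → ℝ) :
    ∀ᵐ ξ ∂(lerayMeasure m₁ m₂), ∀ k, ξ.2.arg ≠ -a k := by
  filter_upwards [ae_mem_box_compl_of_countable hm₁ hm₂ (countable_range fun k => -a k)]
    with ξ hξ k hk using hξ.2.2.1 ⟨k, hk.symm⟩

lemma ofReal_norm_testFun_rpow_le (ha : IsHalving a) (hcoeff : ∀ k, 1 ≤ coeff p₀ ψ (a k))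
    {ξ : ℂ × ℂ} (hξ : ∀ k, ξ.2.arg ≠ -a k) {q : ℝ} (hq0 : 0 < q)
    (hq : ∀ k, ξ ∈ patch m₁ m₂ γ₁ γ₂ (a k) → q ≤ p₀) :
    ENNReal.ofReal (‖testFun m₁ m₂ γ₁ γ₂ p₀ ψ a ξ‖ ^ q)
      ≤ ∑' k, (patch m₁ m₂ γ₁ γ₂ (a k)).indicator
        (fun _ => ENNReal.ofReal (coeff p₀ ψ (a k) ^ p₀)) ξ := by
  by_cases h : ∃ k, ξ ∈ patch m₁ m₂ γ₁ γ₂ (a k)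
  · obtain ⟨k, hk⟩ := h
    refine le_trans ?_ (ENNReal.le_tsum k)
    rw [testFun_of_mem ha hξ hk, indicator_of_mem hk, Complex.norm_real,
      norm_of_nonneg (zero_le_one.trans (hcoeff k))]
    exact ENNReal.ofReal_le_ofReal (rpow_le_rpow_of_exponent_le (hcoeff k) (hq k hk))
  · rw [testFun_of_forall_notMem (not_exists.1 h), norm_zero, zero_rpow hq0.ne',
      ENNReal.ofReal_zero]
    exact zero_le

lemma lintegral_testFun_rpow_lt_top (hm₁ : 0 < m₁) (hm₂ : 0 < m₂) (hγ₁ : 0 < γ₁) (hγ : γ₁ ≤ γ₂)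
    (hp₀ : 0 < p₀) (ha : Admissible p₀ ψ α₀ a) (hπ : ∀ k, 2 * a k < π) (hγa : ∀ k, γ₂ * a k < 1)
    (hcoeff : ∀ k, 1 ≤ coeff p₀ ψ (a k)) {q : ℂ × ℂ → ℝ} (hq0 : ∀ ξ, 0 < q ξ)
    (hq : ∀ k, ∀ ξ ∈ patch m₁ m₂ γ₁ γ₂ (a k), q ξ ≤ p₀) :
    ∫⁻ ξ, ENNReal.ofReal (‖testFun m₁ m₂ γ₁ γ₂ p₀ ψ a ξ‖ ^ q ξ) ∂(lerayMeasure m₁ m₂) < ⊤ := by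
  set C : ℝ := m₁ * m₂ * (γ₂ - γ₁) * (π / 12) with hC
  have hC0 : 0 ≤ C := by have := sub_nonneg.2 hγ; positivity
  calc ∫⁻ ξ, ENNReal.ofReal (‖testFun m₁ m₂ γ₁ γ₂ p₀ ψ a ξ‖ ^ q ξ) ∂(lerayMeasure m₁ m₂)
      ≤ ∫⁻ ξ, ∑' k, (patch m₁ m₂ γ₁ γ₂ (a k)).indicator
          (fun _ => ENNReal.ofReal (coeff p₀ ψ (a k) ^ p₀)) ξ ∂(lerayMeasure m₁ m₂) := by
        refine lintegral_mono_ae ?_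
        filter_upwards [ae_arg_snd_ne_neg hm₁ hm₂ a] with ξ hξ using
          ofReal_norm_testFun_rpow_le ha.isHalving hcoeff hξ (hq0 ξ) fun k => hq k ξ
    _ = ∑' k, ENNReal.ofReal (C * (coeff p₀ ψ (a k) ^ p₀ * a k ^ 2)) := by
        rw [lintegral_tsum fun k =>
          (measurable_const.indicator (measurableSet_patch ..)).aemeasurable]
        refine tsum_congr fun k => ?_
        have := hcoeff k
        rw [lintegral_indicator_const (measurableSet_patch ..),
          lerayMeasure_patch hm₁ hm₂ hγ₁ hγ (ha.pos k) (hπ k) (hγa k),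
          ← ENNReal.ofReal_mul (by positivity), ← hC]
        ring_nf
    _ ≤ ∑' k : ℕ, ENNReal.ofReal (C * (1 / 4) ^ (k + 1)) := ENNReal.tsum_le_tsum fun k =>
        ENNReal.ofReal_le_ofReal
          (mul_le_mul_of_nonneg_left (ha.coeff_rpow_mul_sq_le hp₀ k) hC0)
    _ < ⊤ := by
        rw [← ENNReal.ofReal_tsum_of_nonneg (fun k => by positivity)]
        · exact ENNReal.ofReal_lt_top
        · exact ((summable_nat_add_iff 1).2
            (summable_geometric_of_lt_one (by norm_num) (by norm_num))).mul_left C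

lemma Admissible.memLpVar_testFun {δ : ℝ} (ha : Admissible p₀ ψ α₀ a) (hm₁ : 0 < m₁)
    (hm₂ : 0 < m₂) (hγ₁ : 0 < γ₁) (hγ : γ₁ ≤ γ₂) (hp₀ : 1 ≤ p₀)
    (hp : ∀ t ∈ Ioc (-π) π, 0 < p₀ + ψ t) (hα₀ : α₀ ≤ 1) (hγα₀ : γ₂ * α₀ ≤ 1)
    (hα₀δ : 2 * α₀ ≤ δ) (hneg : ∀ t ∈ Ico (-δ) 0, ψ t ≤ 0) :
    MemLpVar m₁ m₂ (exponent p₀ ψ) (testFun m₁ m₂ γ₁ γ₂ p₀ ψ a) := by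
  have hp₀' : 0 < p₀ := by linarith
  have ha0 := ha.pos
  have hlt := ha.lt
  have h3 := pi_gt_three
  have hπ : ∀ k, 2 * a k < π := fun k => by linarith [hlt k]
  have hγa : ∀ k, γ₂ * a k < 1 := fun k =>
    (mul_lt_mul_of_pos_left (hlt k) (hγ₁.trans_le hγ)).trans_le hγα₀
  have hcoeff : ∀ k, 1 ≤ coeff p₀ ψ (a k) := fun k =>
    one_le_coeff (ha0 k) (by linarith [hlt k])
      (hp _ ⟨by linarith [ha0 k], by linarith [hlt k]⟩).le
  refine ⟨⟨measurable_testFun.aestronglyMeasurable, ?_⟩, 1, one_pos, ?_⟩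
  · have hlt := lintegral_testFun_rpow_lt_top hm₁ hm₂ hγ₁ hγ hp₀' ha hπ hγa hcoeff
      (q := fun _ => 1) (fun _ => one_pos) fun _ _ _ => hp₀
    simpa [HasFiniteIntegral, ofReal_norm] using hlt
  · simp only [modular, Complex.ofReal_one, one_mul]
    refine lintegral_testFun_rpow_lt_top hm₁ hm₂ hγ₁ hγ hp₀' ha hπ hγa hcoeff
      (fun ξ => hp _ ⟨Complex.neg_pi_lt_arg _, Complex.arg_le_pi _⟩) fun k ξ hξ => ?_
    rw [exponent]
    linarith [hneg ξ.2.arg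
      ⟨by linarith [hξ.2.2.1.1, hlt k], by linarith [hξ.2.2.1.2, ha0 k]⟩]

end Membership

section ImageLowerBound

lemma mul_measureReal_le_norm_cauchyLF {m₁ m₂ A : ℝ} {f : ℂ × ℂ → ℂ} {z : ℂ × ℂ}
    {P : Set (ℂ × ℂ)} (hm₁ : 0 < m₁) (hm₂ : 0 < m₂)
    (hint : Integrable (fun ξ => f ξ / w m₁ m₂ ξ z ^ 2) (lerayMeasure m₁ m₂))
    (hP : MeasurableSet P)
    (hA : ∀ᵐ ξ ∂(lerayMeasure m₁ m₂),
      P.indicator (fun _ => A) ξ ≤ -(f ξ / w m₁ m₂ ξ z ^ 2).re) :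
    1 / (4 * π ^ 2) * (A * (lerayMeasure m₁ m₂).real P) ≤ ‖cauchyLF m₁ m₂ f z‖ := by
  have := isFiniteMeasure_lerayMeasure hm₁ hm₂
  have hnorm : ‖1 / (2 * (π : ℂ) * Complex.I) ^ 2‖ = 1 / (4 * π ^ 2) := by
    simp only [norm_div, norm_one, norm_pow, norm_mul, Complex.norm_ofNat, Complex.norm_real,
      Complex.norm_I, mul_one, norm_of_nonneg pi_pos.le]
    ring
  rw [cauchyLF, norm_mul, hnorm]
  refine mul_le_mul_of_nonneg_left ?_ (by positivity)
  calc A * (lerayMeasure m₁ m₂).real P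
      = ∫ ξ, P.indicator (fun _ => A) ξ ∂(lerayMeasure m₁ m₂) := by
        rw [integral_indicator_const _ hP, smul_eq_mul, mul_comm]
    _ ≤ ∫ ξ, -(f ξ / w m₁ m₂ ξ z ^ 2).re ∂(lerayMeasure m₁ m₂) :=
        integral_mono_ae ((integrable_const A).indicator hP) hint.re.neg hA
    _ = -(∫ ξ, f ξ / w m₁ m₂ ξ z ^ 2 ∂(lerayMeasure m₁ m₂)).re := by
        rw [integral_neg]
        exact congrArg _ (integral_re hint)
    _ ≤ _ := (neg_le_abs _).trans (Complex.abs_re_le_norm _)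

variable {m₁ m₂ γ₁ γ₂ p₀ α β : ℝ} {ψ : ℝ → ℝ} {a : ℕ → ℝ} {ξ z : ℂ × ℂ}

lemma le_neg_one_div_w_sq_re_of_mem_patch (hm₁ : 1 ≤ m₁) (hm₂ : 1 ≤ m₂)
    (hγ₂ : 100 * m₁ * γ₂ ≤ 1) (hα0 : 0 < α) (hα : α ≤ 1 / 200) (hβ0 : 0 < β) (hβ : β ≤ 1 / 200)
    (hξ : ξ ∈ patch m₁ m₂ γ₁ γ₂ β) (hz : z ∈ oppositePatch m₁ m₂ γ₁ γ₂ α) :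
    1 / (1000 * (m₂ * (α + β)) ^ 2) ≤ -(1 / w m₁ m₂ ξ z ^ 2).re := by
  obtain ⟨hξb, -, hξarg, -, hξ1⟩ := hξ
  obtain ⟨hzb, -, hzarg, -, hz1⟩ := hz
  refine le_neg_one_div_w_sq_re hm₁ hm₂ (by linarith) (by linarith) hξb hzb
    ⟨by linarith [hξarg.2, hzarg.1], by linarith [hξarg.1, hzarg.2]⟩ ?_
  calc m₁ * (‖ξ.1‖ ^ (2 * m₁) + ‖z.1‖ ^ (2 * m₁)) ≤ m₁ * (γ₂ * β + γ₂ * α) := by gcongr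
    _ = 100 * m₁ * γ₂ * (α + β) / 100 := by ring
    _ ≤ 1 * (α + β) / 100 := by gcongr
    _ = (α + β) / 100 := by ring

lemma indicator_patch_le_neg_testFun_div_w_sq_re (hm₁ : 1 ≤ m₁) (hm₂ : 1 ≤ m₂)
    (hγ₂ : 100 * m₁ * γ₂ ≤ 1) (ha : IsHalving a) (hlt : ∀ k, a k ≤ 1 / 200)
    (hξ : ∀ k, ξ.2.arg ≠ -a k) {k : ℕ} (hz : z ∈ oppositePatch m₁ m₂ γ₁ γ₂ (a k)) :
    (patch m₁ m₂ γ₁ γ₂ (a k)).indicator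
        (fun _ => coeff p₀ ψ (a k) * (1 / (1000 * (m₂ * (a k + a k)) ^ 2))) ξ
      ≤ -(testFun m₁ m₂ γ₁ γ₂ p₀ ψ a ξ / w m₁ m₂ ξ z ^ 2).re := by
  by_cases h : ∃ j, ξ ∈ patch m₁ m₂ γ₁ γ₂ (a j)
  · obtain ⟨j, hj⟩ := h
    have hker := le_neg_one_div_w_sq_re_of_mem_patch hm₁ hm₂ hγ₂ (ha.pos k) (hlt k) (ha.pos j)
      (hlt j) hj hz
    have hcoeff : 0 ≤ coeff p₀ ψ (a j) := rpow_nonneg (ha.pos j).le _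
    rw [testFun_of_mem ha hξ hj, div_eq_mul_one_div (coeff p₀ ψ (a j) : ℂ),
      Complex.re_ofReal_mul, ← mul_neg]
    refine le_trans ?_ (mul_le_mul_of_nonneg_left hker hcoeff)
    refine indicator_apply_le' (fun hk => ?_) fun _ => by positivity
    rw [eq_of_mem_patch ha hξ hj hk]
  · rw [testFun_of_forall_notMem (not_exists.1 h),
      indicator_of_notMem fun hk => h ⟨k, hk⟩]
    simp

lemma eventually_testFun_eq_zero (ha : ∀ k, 0 < a k) (hz0 : 0 < z.2.arg) (hzπ : z.2.arg ≠ π) :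
    ∀ᶠ ξ in 𝓝[bdry m₁ m₂] z, testFun m₁ m₂ γ₁ γ₂ p₀ ψ a ξ = 0 := by
  have harg : Tendsto (fun ξ : ℂ × ℂ => ξ.2.arg) (𝓝[bdry m₁ m₂] z) (𝓝 z.2.arg) :=
    (continuousAt_arg_of_arg_ne hz0.ne' hzπ).tendsto.comp
      (continuous_snd.continuousWithinAt (x := z))
  filter_upwards [harg.eventually (lt_mem_nhds hz0)] with ξ hξ using testFun_of_arg_pos ha hξ

lemma eventually_testFun_eq_zero_of_mem_oppositePatch (ha : ∀ k, 0 < a k) {k : ℕ}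
    (hπ : 2 * a k ≤ π) (hz : z ∈ oppositePatch m₁ m₂ γ₁ γ₂ (a k)) :
    ∀ᶠ ξ in 𝓝[bdry m₁ m₂] z, testFun m₁ m₂ γ₁ γ₂ p₀ ψ a ξ = 0 :=
  eventually_testFun_eq_zero ha ((ha k).trans hz.2.2.1.1) (hz.2.2.1.2.trans_le hπ).ne

lemma le_norm_cauchyLF_testFun (hm₁ : 1 ≤ m₁) (hm₂ : 1 ≤ m₂) (hγ₁ : 0 < γ₁) (hγ : γ₁ ≤ γ₂)
    (hγ₂ : 100 * m₁ * γ₂ ≤ 1) (ha : IsHalving a) (hlt : ∀ k, a k ≤ 1 / 200)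
    (hint : Integrable (testFun m₁ m₂ γ₁ γ₂ p₀ ψ a) (lerayMeasure m₁ m₂)) {k : ℕ}
    (hz : z ∈ oppositePatch m₁ m₂ γ₁ γ₂ (a k)) :
    m₁ * (γ₂ - γ₁) / (192000 * π * m₂) * coeff p₀ ψ (a k)
      ≤ ‖cauchyLF m₁ m₂ (testFun m₁ m₂ γ₁ γ₂ p₀ ψ a) z‖ := by
  have hm₁' : 0 < m₁ := by linarith
  have hm₂' : 0 < m₂ := by linarith
  have hak := ha.pos k
  have hakπ : 2 * a k < π := by linarith [hlt k, pi_gt_three]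
  have hγa : γ₂ * a k < 1 := by nlinarith [hlt k]
  obtain ⟨η, hη, hw⟩ := exists_eq_zero_or_le_norm_w hm₁ hm₂ hz.1
    (eventually_testFun_eq_zero_of_mem_oppositePatch (p₀ := p₀) (ψ := ψ) ha.pos hakπ.le hz)
  have hint_w := integrable_div_w_sq hm₁' hm₂' hint hη fun ξ hξ => by
    simpa only [one_smul] using hw ξ hξ 1 (right_mem_Icc.2 zero_le_one)
  have hmain := mul_measureReal_le_norm_cauchyLF hm₁' hm₂' hint_w (measurableSet_patch ..)
    ((ae_arg_snd_ne_neg hm₁' hm₂' a).mono fun ξ hξ =>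
      indicator_patch_le_neg_testFun_div_w_sq_re hm₁ hm₂ hγ₂ ha hlt hξ hz)
  rw [Measure.real, lerayMeasure_patch hm₁' hm₂' hγ₁ hγ hak hakπ hγa,
    ENNReal.toReal_ofReal (by have := sub_nonneg.2 hγ; positivity)] at hmain
  convert hmain using 1
  field_simp
  ring

lemma ae_le_norm_image_testFun (hm₁ : 1 ≤ m₁) (hm₂ : 1 ≤ m₂) (hγ₁ : 0 < γ₁) (hγ : γ₁ ≤ γ₂)
    (hγ₂ : 100 * m₁ * γ₂ ≤ 1) (ha : IsHalving a) (hlt : ∀ k, a k ≤ 1 / 200)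
    (hint : Integrable (testFun m₁ m₂ γ₁ γ₂ p₀ ψ a) (lerayMeasure m₁ m₂)) {g : ℂ × ℂ → ℂ}
    (hg : IsImage m₁ m₂ (testFun m₁ m₂ γ₁ γ₂ p₀ ψ a) g) :
    ∀ᵐ z ∂(lerayMeasure m₁ m₂), ∀ k, z ∈ oppositePatch m₁ m₂ γ₁ γ₂ (a k) →
      m₁ * (γ₂ - γ₁) / (192000 * π * m₂) * coeff p₀ ψ (a k) ≤ ‖g z‖ := by
  filter_upwards [hg] with z hgz k hz
  have hlim := tendsto_cauchyLF_of_eventually_eq_zero hm₁ hm₂ hint hz.1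
    (eventually_testFun_eq_zero_of_mem_oppositePatch ha.pos
      (by linarith [hlt k, pi_gt_three]) hz)
  rw [tendsto_nhds_unique hgz hlim]
  exact le_norm_cauchyLF_testFun hm₁ hm₂ hγ₁ hγ hγ₂ ha hlt hint hz

end ImageLowerBound

section Divergence

lemma lintegral_eq_top_of_forall_le_setLIntegral {X : Type*} [MeasurableSpace X] {μ : Measure X}
    {s : ℕ → Set X} (hs : ∀ k, MeasurableSet (s k)) (hd : Pairwise (Function.onFun Disjoint s))
    {f : X → ENNReal} {c : ENNReal} (hc : c ≠ 0) (hf : ∀ k, c ≤ ∫⁻ x in s k, f x ∂μ) :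
    ∫⁻ x, f x ∂μ = ⊤ := by
  rw [eq_top_iff]
  calc (⊤ : ENNReal) = ∑' _ : ℕ, c := (ENNReal.tsum_const_eq_top_of_ne_zero hc).symm
    _ ≤ ∑' k, ∫⁻ x in s k, f x ∂μ := ENNReal.tsum_le_tsum hf
    _ = ∫⁻ x in ⋃ k, s k, f x ∂μ := (lintegral_iUnion hs hd _).symm
    _ ≤ ∫⁻ x, f x ∂μ := setLIntegral_le_lintegral _ _

lemma rpow_mul_rpow_le_mul_rpow {s b q₀ q M : ℝ} (hs0 : 0 < s) (hs1 : s ≤ 1) (hb : 1 ≤ b)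
    (hq₀ : q₀ ≤ q) (hM : q ≤ M) : s ^ M * b ^ q₀ ≤ (s * b) ^ q := by
  rw [mul_rpow hs0.le (by linarith)]
  exact mul_le_mul (rpow_le_rpow_of_exponent_ge hs0 hs1 hM) (rpow_le_rpow_of_exponent_le hb hq₀)
    (by positivity) (by positivity)

variable {m₁ m₂ γ₁ γ₂ p₀ α δ : ℝ} {ψ : ℝ → ℝ} {a : ℕ → ℝ}

lemma le_setLIntegral_oppositePatch {s M : ℝ} {f : ℂ × ℂ → ℂ} {q : ℂ × ℂ → ℝ} (hm₁ : 0 < m₁)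
    (hm₂ : 0 < m₂) (hγ₁ : 0 < γ₁) (hγ : γ₁ ≤ γ₂) (hα : 0 < α) (hα1 : α ≤ 1) (hαπ : 2 * α ≤ π)
    (hγα : γ₂ * α < 1) (hp : 0 < p₀ + ψ α) (hs0 : 0 < s) (hs1 : s ≤ 1)
    (hf : ∀ᵐ ξ ∂(lerayMeasure m₁ m₂), ξ ∈ oppositePatch m₁ m₂ γ₁ γ₂ α →
      s * coeff p₀ ψ α ≤ ‖f ξ‖)
    (hq : ∀ ξ ∈ oppositePatch m₁ m₂ γ₁ γ₂ α, q ξ ∈ Icc (p₀ + ψ α) M) :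
    ENNReal.ofReal (s ^ M * (m₁ * m₂ * (γ₂ - γ₁) * (2 * π))) ≤
      ∫⁻ ξ in oppositePatch m₁ m₂ γ₁ γ₂ α, ENNReal.ofReal (‖f ξ‖ ^ q ξ)
        ∂(lerayMeasure m₁ m₂) := by
  have hmeas := measurableSet_oppositePatch m₁ m₂ γ₁ γ₂ α
  have hcoeff := one_le_coeff hα hα1 hp.le
  calc ENNReal.ofReal (s ^ M * (m₁ * m₂ * (γ₂ - γ₁) * (2 * π)))
      = ∫⁻ _ in oppositePatch m₁ m₂ γ₁ γ₂ α, ENNReal.ofReal (s ^ M * (α ^ 2)⁻¹)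
          ∂(lerayMeasure m₁ m₂) := by
        rw [setLIntegral_const, lerayMeasure_oppositePatch hm₁ hm₂ hγ₁ hγ hα hαπ hγα,
          ← ENNReal.ofReal_mul (by positivity)]
        congr 1
        field_simp
    _ ≤ _ := by
        refine lintegral_mono_ae ?_
        filter_upwards [ae_restrict_mem hmeas, ae_restrict_of_ae hf] with ξ hξ hfξ
        obtain ⟨hlow, hupp⟩ := hq ξ hξ
        rw [← coeff_rpow hα.le hp.ne']
        refine ENNReal.ofReal_le_ofReal
          ((rpow_mul_rpow_le_mul_rpow hs0 hs1 hcoeff hlow hupp).trans ?_)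
        exact rpow_le_rpow (by positivity) (hfξ hξ) (hp.le.trans hlow)

lemma exponent_mem_Icc (hmono : MonotoneOn ψ (Icc 0 δ)) (hα : 0 ≤ α) (hαδ : 2 * α ≤ δ)
    {ξ : ℂ × ℂ} (hξ : ξ.2.arg ∈ Icc α (2 * α)) :
    exponent p₀ ψ ξ ∈ Icc (p₀ + ψ α) (p₀ + ψ δ) := by
  have hξδ : ξ.2.arg ∈ Icc 0 δ := ⟨hα.trans hξ.1, hξ.2.trans hαδ⟩
  exact ⟨add_le_add_right (hmono ⟨hα, by linarith⟩ hξδ hξ.1) _,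
    add_le_add_right (hmono hξδ ⟨by linarith, le_rfl⟩ hξδ.2) _⟩

lemma modular_image_testFun_eq_top (hm₁ : 1 ≤ m₁) (hm₂ : 1 ≤ m₂) (hγ₁ : 0 < γ₁) (hγ : γ₁ < γ₂)
    (hγ₂ : 100 * m₁ * γ₂ ≤ 1) (ha : IsHalving a) (hlt : ∀ k, a k ≤ 1 / 200)
    (hδ : ∀ k, 2 * a k ≤ δ) (hmono : MonotoneOn ψ (Icc 0 δ)) (hp : ∀ k, 0 < p₀ + ψ (a k))
    (hint : Integrable (testFun m₁ m₂ γ₁ γ₂ p₀ ψ a) (lerayMeasure m₁ m₂)) {g : ℂ × ℂ → ℂ}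
    (hg : IsImage m₁ m₂ (testFun m₁ m₂ γ₁ γ₂ p₀ ψ a) g) {t : ℝ} (ht : 0 < t) :
    modular m₁ m₂ (exponent p₀ ψ) (fun ξ => (t : ℂ) * g ξ) = ⊤ := by
  have := sub_pos.2 hγ
  set c : ℝ := m₁ * (γ₂ - γ₁) / (192000 * π * m₂)
  set s : ℝ := min (t * c) 1
  have hs0 : 0 < s := lt_min (by positivity) one_pos
  refine lintegral_eq_top_of_forall_le_setLIntegral
    (fun k => measurableSet_oppositePatch m₁ m₂ γ₁ γ₂ (a k)) (pairwise_disjoint_oppositePatch ha)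
    (c := ENNReal.ofReal (s ^ (p₀ + ψ δ) * (m₁ * m₂ * (γ₂ - γ₁) * (2 * π))))
    (ENNReal.ofReal_pos.2 (by positivity)).ne' fun k => ?_
  have hak := ha.pos k
  have hγa : γ₂ * a k < 1 := by nlinarith [hlt k]
  refine le_setLIntegral_oppositePatch (by linarith) (by linarith) hγ₁ hγ.le hak
    (by linarith [hlt k]) (by linarith [hlt k, pi_gt_three]) hγa (hp k) hs0 (min_le_right _ _) ?_
    fun ξ hξ => exponent_mem_Icc hmono hak.le (hδ k) (Ioo_subset_Icc_self hξ.2.2.1)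
  filter_upwards [ae_le_norm_image_testFun hm₁ hm₂ hγ₁ hγ.le hγ₂ ha hlt hint hg] with ξ hgξ hξ
  have hcoeff : 0 ≤ coeff p₀ ψ (a k) := rpow_nonneg hak.le _
  calc s * coeff p₀ ψ (a k) ≤ t * c * coeff p₀ ψ (a k) := by gcongr; exact min_le_left _ _
    _ = t * (c * coeff p₀ ψ (a k)) := mul_assoc _ _ _
    _ ≤ t * ‖g ξ‖ := by gcongr; exact hgξ k hξ
    _ = ‖(t : ℂ) * g ξ‖ := by rw [norm_mul, Complex.norm_real, norm_of_nonneg ht.le]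

end Divergence

section ExistsAdmissible

lemma exists_isHalving_forall {P : ℕ → ℝ → Prop} (hP : ∀ k, ∀ᶠ α in 𝓝[>] 0, P k α) :
    ∃ a, IsHalving a ∧ ∀ k, P k (a k) := by
  have hstep : ∀ k x, 0 < x → ∃ α, 0 < α ∧ 2 * α ≤ x ∧ P k α := fun k x hx => by
    obtain ⟨α, hα, hPα⟩ := ((eventually_mem_set.2 (Ioo_mem_nhdsGT (half_pos hx))).and (hP k)).exists
    exact ⟨α, hα.1, by linarith [hα.2], hPα⟩
  choose! next hpos hle hnext using hstep
  let a : ℕ → ℝ := fun n => n.rec (next 0 1) fun k x => next (k + 1) x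
  have ha : ∀ k, 0 < a k := fun k => by
    induction k with
    | zero => exact hpos 0 1 one_pos
    | succ k ih => exact hpos (k + 1) (a k) ih
  refine ⟨a, ⟨ha, fun k => hle (k + 1) (a k) (ha k)⟩, fun k => ?_⟩
  cases k with
  | zero => exact hnext 0 1 one_pos
  | succ k => exact hnext (k + 1) (a k) (ha k)

variable {p₀ M α₀ : ℝ} {ψ : ℝ → ℝ}

lemma eventually_pos_of_tendsto_mul_log
    (hlim : Tendsto (fun t : ℝ => ψ t * log (1 / t)) (𝓝[>] 0) atTop) :
    ∀ᶠ α in 𝓝[>] 0, 0 < ψ α := by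
  filter_upwards [hlim.eventually_gt_atTop 0, Ioo_mem_nhdsGT one_pos] with α hα hα1
  exact pos_of_mul_pos_left hα (log_nonneg (one_le_one_div hα1.1 hα1.2.le))

lemma one_div_rpow_le_exp {α y : ℝ} (hp₀ : 0 < p₀) (hα0 : 0 < α) (hα1 : α ≤ 1) (hy0 : 0 ≤ y)
    (hyM : y ≤ M) : (1 / α) ^ (1 / (p₀ + y) - 1 / p₀)
      ≤ exp (-(1 / (p₀ * (p₀ + M)) * (y * log (1 / α)))) := by
  have hlog : 0 ≤ log (1 / α) := log_nonneg (one_le_one_div hα0 hα1)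
  have hdiff : 1 / (p₀ + y) - 1 / p₀ = -(y / (p₀ * (p₀ + y))) := by
    field_simp
    ring
  rw [rpow_def_of_pos (by positivity), hdiff]
  refine exp_le_exp.2 ?_
  calc log (1 / α) * -(y / (p₀ * (p₀ + y))) = -(1 / (p₀ * (p₀ + y)) * (y * log (1 / α))) := by ring
    _ ≤ -(1 / (p₀ * (p₀ + M)) * (y * log (1 / α))) := by gcongr

lemma tendsto_one_div_rpow (hp₀ : 0 < p₀) (hM : ∀ᶠ α in 𝓝[>] 0, ψ α ≤ M)
    (hlim : Tendsto (fun t : ℝ => ψ t * log (1 / t)) (𝓝[>] 0) atTop) :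
    Tendsto (fun α : ℝ => (1 / α) ^ (1 / (p₀ + ψ α) - 1 / p₀)) (𝓝[>] 0) (𝓝 0) := by
  have hpos := eventually_pos_of_tendsto_mul_log hlim
  obtain ⟨α, hα, hαM⟩ := (hpos.and hM).exists
  have hM0 : 0 < M := hα.trans_le hαM
  refine squeeze_zero' ?_ ?_ (tendsto_exp_neg_atTop_nhds_zero.comp
    (hlim.const_mul_atTop (show 0 < 1 / (p₀ * (p₀ + M)) by positivity)))
  · filter_upwards [self_mem_nhdsWithin] with α hα
    exact rpow_nonneg (one_div_nonneg.2 (le_of_lt hα)) _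
  · filter_upwards [hpos, hM, Ioo_mem_nhdsGT one_pos] with α hα hαM hα1
    exact one_div_rpow_le_exp hp₀ hα1.1 hα1.2.le hα.le hαM

lemma exists_admissible (hp₀ : 0 < p₀) (hM : ∀ᶠ α in 𝓝[>] 0, ψ α ≤ M)
    (hlim : Tendsto (fun t : ℝ => ψ t * log (1 / t)) (𝓝[>] 0) atTop) (hα₀ : 0 < α₀) :
    ∃ a, Admissible p₀ ψ α₀ a := by
  obtain ⟨a, ha, hdecay⟩ := exists_isHalving_forall fun k : ℕ =>
    ((eventually_lt_nhds hα₀).filter_mono nhdsWithin_le_nhds).and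
      ((tendsto_one_div_rpow hp₀ hM hlim).eventually
        (ge_mem_nhds (show 0 < (2 : ℝ) ^ (-((k : ℝ) + 1) / p₀) by positivity)))
  exact ⟨a, ha.pos, fun k => (hdecay k).1, ha.two_mul_succ_le, fun k => (hdecay k).2⟩

end ExistsAdmissible

section NotLogHolder

lemma div_abs_log_le {C L x d : ℝ} (hL : 1 ≤ L) (hx : 0 ≤ x) (hxd : x ≤ L * d)
    (hd1 : d * L ^ 2 < 1) : C / |log x| ≤ 2 * |C| / |log d| := by
  rcases hx.eq_or_lt with rfl | hx0
  · rw [log_zero, abs_zero, div_zero]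
    positivity
  have hL0 : 0 < L := by linarith
  have hd0 : 0 < d := pos_of_mul_pos_right (hx0.trans_le hxd) hL0.le
  have hlogL : 0 ≤ log L := log_nonneg hL
  have hlogd : log d + 2 * log L < 0 := by
    have := log_neg (by positivity) hd1
    rwa [log_mul hd0.ne' (by positivity), log_pow] at this
  have hlogx : log x ≤ log L + log d := by
    rw [← log_mul hL0.ne' hd0.ne']
    exact log_le_log hx0 hxd
  have hlog : |log d| / 2 ≤ |log x| := by
    rw [abs_of_neg (by linarith), abs_of_neg (by linarith)]
    linarith
  have hlogd0 : 0 < |log d| := abs_pos.2 (by linarith)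
  calc C / |log x| ≤ |C| / |log x| := by gcongr; exact le_abs_self C
    _ ≤ |C| / (|log d| / 2) := by gcongr
    _ = 2 * |C| / |log d| := by field_simp

lemma exists_div_abs_log_lt {ψ : ℝ → ℝ}
    (hlim : Tendsto (fun t : ℝ => ψ t * log (1 / t)) (𝓝[>] 0) atTop) (C : ℝ) {δ : ℝ}
    (hδ : 0 < δ) : ∃ α ∈ Ioo 0 δ, ∀ d ∈ Icc 0 α, C / |log d| < ψ α := by
  obtain ⟨α, hα, hα1, hαδ⟩ := ((hlim.eventually_gt_atTop (2 * |C|)).and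
    (eventually_mem_set.2 (inter_mem (Ioo_mem_nhdsGT one_pos) (Ioo_mem_nhdsGT hδ)))).exists
  have hlog : |log α| = log (1 / α) := by
    rw [abs_of_neg (log_neg hα1.1 hα1.2), one_div, log_inv]
  have hlog0 : 0 < log (1 / α) := log_pos (one_lt_one_div hα1.1 hα1.2)
  refine ⟨α, hαδ, fun d hd =>
    (div_abs_log_le (d := α) le_rfl hd.1 (by linarith [hd.2]) (by linarith [hα1.2])).trans_lt ?_⟩
  rwa [hlog, div_lt_iff₀ hlog0]

variable {m₁ m₂ p₀ α : ℝ} {ψ : ℝ → ℝ} {ξ : ℂ × ℂ}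

lemma rotate_snd_mem_bdry (hξ : ξ ∈ bdry m₁ m₂) (α : ℝ) :
    (ξ.1, Complex.exp (Complex.I * α) * ξ.2) ∈ bdry m₁ m₂ := by
  have hnorm : ‖Complex.exp (Complex.I * α) * ξ.2‖ = ‖ξ.2‖ := by
    rw [norm_mul, Complex.norm_exp_I_mul_ofReal, one_mul]
  rwa [bdry, mem_ofPred_eq, hnorm]

lemma arg_exp_mul_of_arg_eq_zero {x : ℂ} (hx : x ≠ 0) (harg : x.arg = 0) (hα : α ∈ Ioc (-π) π) :
    (Complex.exp (Complex.I * α) * x).arg = α := by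
  have hexp : (Complex.exp (Complex.I * α)).arg = α := by
    rw [mul_comm, Complex.arg_exp_mul_I, toIocMod_eq_self]
    convert hα using 1
    ring_nf
  rw [Complex.arg_mul (Complex.exp_ne_zero _) hx (by rwa [hexp, harg, add_zero]), hexp, harg,
    add_zero]

lemma edist₂_rotate_snd_le (hξ : ‖ξ.2‖ ≤ 1) (α : ℝ) :
    edist₂ (ξ.1, Complex.exp (Complex.I * α) * ξ.2) ξ ≤ |α| := by
  have hsnd : ‖Complex.exp (Complex.I * α) * ξ.2 - ξ.2‖ ≤ |α| := by
    rw [← sub_one_mul, norm_mul]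
    exact (mul_le_of_le_one_right (norm_nonneg _) hξ).trans
      Real.norm_exp_I_mul_ofReal_sub_one_le
  simpa [edist₂] using hsnd

lemma not_logHolderNear (hm₂ : 0 < m₂) (hψ0 : ψ 0 = 0)
    (hlim : Tendsto (fun t : ℝ => ψ t * log (1 / t)) (𝓝[>] 0) atTop) (hξ : ξ ∈ bdry m₁ m₂)
    (h0 : ξ.2 ≠ 0) (harg : ξ.2.arg = 0) : ¬LogHolderNear m₁ m₂ (exponent p₀ ψ) ξ := by
  rintro ⟨C, δ, hδ, hH⟩
  obtain ⟨α, ⟨hα0, hα⟩, hlt⟩ := exists_div_abs_log_lt hlim C (lt_min hδ pi_pos)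
  have hαδ := hα.trans_le (min_le_left _ _)
  have hαπ := hα.trans_le (min_le_right _ _)
  have hd := edist₂_rotate_snd_le
    (norm_le_one_of_rpow_le_one hm₂ (norm_snd_rpow_le_one hξ)) α
  rw [abs_of_pos hα0] at hd
  have hself : edist₂ ξ ξ < δ := by simpa [edist₂] using hδ
  have hbound := hH _ (rotate_snd_mem_bdry hξ α) ξ hξ (hd.trans_lt hαδ) hself
  rw [exponent, exponent, arg_exp_mul_of_arg_eq_zero h0 harg ⟨by linarith, hαπ.le⟩, harg, hψ0,
    add_sub_add_left_eq_sub, sub_zero] at hbound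
  exact ((le_abs_self _).trans hbound).not_gt (hlt _ ⟨sqrt_nonneg _, hd⟩)

end NotLogHolder

section LogHolder

variable {X Y : Type*} [PseudoMetricSpace X] [PseudoMetricSpace Y] {S : Set X} {T : Set Y}
  {x : X} {u v : X → ℝ}

/-- Log-Hölder continuity of `u` on `S` near `x`, the common form of `LogHolderNear` and
`LogHolderNearReal` on which the composition rules below operate. -/
def LogHolderWithinAt (u : X → ℝ) (S : Set X) (x : X) : Prop :=
  ∃ C, ∀ᶠ q in 𝓝[S] x ×ˢ 𝓝[S] x, |u q.1 - u q.2| ≤ C / |log (dist q.1 q.2)|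

lemma LogHolderWithinAt.const_add (hu : LogHolderWithinAt u S x) (c : ℝ) :
    LogHolderWithinAt (fun y => c + u y) S x := by
  simpa only [LogHolderWithinAt, add_sub_add_left_eq_sub] using hu

lemma LogHolderWithinAt.mono {U : Set X} (hu : LogHolderWithinAt u U x) (hSU : S ⊆ U) :
    LogHolderWithinAt u S x := by
  obtain ⟨C, hC⟩ := hu
  exact ⟨C, hC.filter_mono (prod_mono (nhdsWithin_mono x hSU) (nhdsWithin_mono x hSU))⟩

lemma LogHolderWithinAt.congr (hu : LogHolderWithinAt u S x) (huv : u =ᶠ[𝓝[S] x] v) :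
    LogHolderWithinAt v S x := by
  obtain ⟨C, hC⟩ := hu
  refine ⟨C, ?_⟩
  filter_upwards [hC, huv.prod_mk huv] with q hq hq'
  rwa [← hq'.1, ← hq'.2]

lemma eventually_dist_lt_prod_self (S : Set X) (x : X) {ε : ℝ} (hε : 0 < ε) :
    ∀ᶠ q in 𝓝[S] x ×ˢ 𝓝[S] x, dist q.1 q.2 < ε := by
  have hdist : Tendsto (fun q : X × X => dist q.1 q.2) (𝓝 x ×ˢ 𝓝 x) (𝓝 0) := by
    simpa only [dist_self] using tendsto_fst.dist (tendsto_snd (f := 𝓝 x) (g := 𝓝 x))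
  exact (hdist.mono_left (prod_mono nhdsWithin_le_nhds nhdsWithin_le_nhds)).eventually_lt_const hε

lemma LogHolderWithinAt.comp_lipschitzOnWith {u : Y → ℝ} {f : X → Y} {K : NNReal} {U : Set X}
    (hu : LogHolderWithinAt u T (f x)) (hf : LipschitzOnWith K f U) (hU : U ∈ 𝓝[S] x)
    (hfT : Tendsto f (𝓝[S] x) (𝓝[T] (f x))) : LogHolderWithinAt (u ∘ f) S x := by
  obtain ⟨C, hC⟩ := hu
  have hL : (1 : ℝ) ≤ 1 + K := le_add_of_nonneg_right K.2
  have hU' : ∀ᶠ y in 𝓝[S] x, y ∈ U := hU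
  refine ⟨2 * |C|, ?_⟩
  filter_upwards [(hfT.prodMap hfT).eventually hC, hU'.prod_mk hU',
    eventually_dist_lt_prod_self S x (show 0 < 1 / (1 + (K : ℝ)) ^ 2 by positivity)]
    with q hq hqU hqd
  refine hq.trans (div_abs_log_le hL dist_nonneg ?_ ((lt_div_iff₀ (by positivity)).1 hqd))
  calc dist (f q.1) (f q.2) ≤ K * dist q.1 q.2 := hf.dist_le_mul _ hqU.1 _ hqU.2
    _ ≤ (1 + K) * dist q.1 q.2 := by gcongr; linarith

lemma LogHolderWithinAt.comp_lipschitzWith {u : Y → ℝ} {f : X → Y} {K : NNReal}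
    (hu : LogHolderWithinAt u T (f x)) (hf : LipschitzWith K f) (hT : ∀ᶠ y in 𝓝[S] x, f y ∈ T) :
    LogHolderWithinAt (u ∘ f) S x :=
  hu.comp_lipschitzOnWith hf.lipschitzOnWith univ_mem
    (tendsto_nhdsWithin_iff.2 ⟨hf.continuous.continuousWithinAt, hT⟩)

lemma LogHolderWithinAt.of_Iic_of_Ici {u : ℝ → ℝ} {x : ℝ} (hl : LogHolderWithinAt u (Iic x) x)
    (hr : LogHolderWithinAt u (Ici x) x) : LogHolderWithinAt u univ x := by
  obtain ⟨C₁, h₁⟩ := hl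
  obtain ⟨C₂, h₂⟩ := hr
  obtain ⟨s₁, hs₁, h₁⟩ := eventually_prod_self_iff'.1 h₁
  obtain ⟨s₂, hs₂, h₂⟩ := eventually_prod_self_iff'.1 h₂
  have hx₁ : x ∈ s₁ := mem_of_mem_nhdsWithin self_mem_Iic hs₁
  have hx₂ : x ∈ s₂ := mem_of_mem_nhdsWithin self_mem_Ici hs₂
  have hnear : ∀ᶠ t in 𝓝[univ] x, (t ≤ x → t ∈ s₁) ∧ (x ≤ t → t ∈ s₂) := by
    rw [nhdsWithin_univ]
    exact (mem_nhdsWithin_iff_eventually.1 hs₁).and (mem_nhdsWithin_iff_eventually.1 hs₂)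
  have hbound : ∀ {C x d : ℝ}, 0 ≤ x → x ≤ d → d < 1 → C / |log x| ≤ 2 * |C| / |log d| :=
    fun hx hxd hd => div_abs_log_le le_rfl hx (by rwa [one_mul]) (by rwa [one_pow, mul_one])
  refine ⟨2 * |C₁| + 2 * |C₂|, ?_⟩
  filter_upwards [hnear.prod_mk hnear, eventually_dist_lt_prod_self univ x one_pos]
    with ⟨a, b⟩ ⟨ha, hb⟩ hd
  dsimp only at ha hb hd ⊢
  have hC₁ : 0 ≤ 2 * |C₁| / |log (dist a b)| := by positivity
  have hC₂ : 0 ≤ 2 * |C₂| / |log (dist a b)| := by positivity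
  rw [add_div]
  wlog hab : a ≤ b generalizing a b
  · rw [abs_sub_comm, dist_comm a b] at *
    exact this b a hb ha (dist_comm a b ▸ hd) hC₁ hC₂ (le_of_not_ge hab)
  rcases le_total b x with hbx | hxb
  · linarith [h₁ a (ha.1 (hab.trans hbx)) b (hb.1 hbx), hbound (C := C₁) dist_nonneg le_rfl hd]
  rcases le_total x a with hxa | hax
  · linarith [h₂ a (ha.2 hxa) b (hb.2 hxb), hbound (C := C₂) dist_nonneg le_rfl hd]
  have hdist : dist a x + dist x b = dist a b := by
    rw [Real.dist_eq, Real.dist_eq, Real.dist_eq, abs_of_nonpos (sub_nonpos.2 hax),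
      abs_of_nonpos (sub_nonpos.2 hxb), abs_of_nonpos (sub_nonpos.2 hab)]
    ring
  calc |u a - u b| ≤ |u a - u x| + |u x - u b| := abs_sub_le _ _ _
    _ ≤ C₁ / |log (dist a x)| + C₂ / |log (dist x b)| :=
      add_le_add (h₁ a (ha.1 hax) x hx₁) (h₂ x hx₂ b (hb.2 hxb))
    _ ≤ 2 * |C₁| / |log (dist a b)| + 2 * |C₂| / |log (dist a b)| :=
      add_le_add (hbound dist_nonneg (hdist ▸ le_add_of_nonneg_right dist_nonneg) hd)
        (hbound dist_nonneg (hdist ▸ le_add_of_nonneg_left dist_nonneg) hd)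

end LogHolder

section LogHolderExponent

variable {m₁ m₂ p₀ : ℝ} {ψ : ℝ → ℝ} {ξ : ℂ × ℂ}

lemma LogHolderNearReal.logHolderWithinAt {s : ℝ} (h : LogHolderNearReal ψ s) :
    LogHolderWithinAt ψ (Icc (-π) π) s := by
  obtain ⟨C, δ, hδ, hH⟩ := h
  have hnear : ∀ᶠ t in 𝓝[Icc (-π) π] s, t ∈ Icc (-π) π ∧ |t - s| < δ :=
    eventually_mem_nhdsWithin.and (nhdsWithin_le_nhds (Metric.ball_mem_nhds s hδ))
  refine ⟨C, ?_⟩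
  filter_upwards [hnear.prod_mk hnear] with q hq
  exact hH q.1 hq.1.1 q.2 hq.2.1 hq.1.2 hq.2.2

lemma dist_le_edist₂ (z z' : ℂ × ℂ) : dist z z' ≤ edist₂ z z' := by
  rw [Prod.dist_eq, dist_eq_norm, dist_eq_norm]
  exact max_le (le_sqrt_of_sq_le (le_add_of_nonneg_right (sq_nonneg _)))
    (le_sqrt_of_sq_le (le_add_of_nonneg_left (sq_nonneg _)))

lemma eventually_edist₂_lt_one (S : Set (ℂ × ℂ)) (ξ : ℂ × ℂ) :
    ∀ᶠ q in 𝓝[S] ξ ×ˢ 𝓝[S] ξ, edist₂ q.1 q.2 < 1 := by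
  have hcont : Continuous fun q : (ℂ × ℂ) × ℂ × ℂ => edist₂ q.1 q.2 := by
    unfold edist₂
    fun_prop
  have hlt : ∀ᶠ q in 𝓝 (ξ, ξ), edist₂ q.1 q.2 < 1 :=
    hcont.continuousAt.eventually_lt_const (by simp [edist₂])
  rw [nhds_prod_eq] at hlt
  exact hlt.filter_mono (prod_mono nhdsWithin_le_nhds nhdsWithin_le_nhds)

lemma LogHolderWithinAt.logHolderNear {p : ℂ × ℂ → ℝ} (h : LogHolderWithinAt p (bdry m₁ m₂) ξ) :
    LogHolderNear m₁ m₂ p ξ := by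
  obtain ⟨C, hC⟩ := h
  obtain ⟨δ, hδ, hH⟩ := (Metric.nhdsWithin_basis_ball.prod_self.eventually_iff).1
    (hC.and (eventually_edist₂_lt_one _ ξ))
  refine ⟨2 * |C|, δ, hδ, fun z hz z' hz' hzξ hz'ξ => ?_⟩
  obtain ⟨hle, hlt⟩ := hH (x := (z, z'))
    ⟨⟨(dist_le_edist₂ z ξ).trans_lt hzξ, hz⟩, (dist_le_edist₂ z' ξ).trans_lt hz'ξ, hz'⟩
  exact hle.trans (div_abs_log_le le_rfl dist_nonneg (by rw [one_mul]; exact dist_le_edist₂ z z')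
    (by rwa [one_pow, mul_one]))

lemma exists_lipschitzOnWith_arg {x : ℂ} (hx : x ∈ Complex.slitPlane) :
    ∃ K, ∃ U ∈ 𝓝 x, LipschitzOnWith K Complex.arg U := by
  obtain ⟨K, U, hU, hK⟩ :=
    (Complex.hasStrictDerivAt_log hx).hasStrictFDerivAt.exists_lipschitzOnWith
  refine ⟨K, U, hU, LipschitzOnWith.of_dist_le_mul fun y hy z hz => ?_⟩
  calc dist y.arg z.arg = |(Complex.log y - Complex.log z).im| := by
        rw [Complex.sub_im, Complex.log_im, Complex.log_im, Real.dist_eq]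
    _ ≤ dist (Complex.log y) (Complex.log z) := by
        rw [dist_eq_norm]
        exact Complex.abs_im_le_norm _
    _ ≤ K * dist y z := hK.dist_le_mul y hy z hz

lemma LogHolderWithinAt.comp_arg {x : ℂ} (hx : x ∈ Complex.slitPlane)
    (hψ : LogHolderWithinAt ψ (Icc (-π) π) x.arg) :
    LogHolderWithinAt (ψ ∘ Complex.arg) univ x := by
  obtain ⟨K, U, hU, hK⟩ := exists_lipschitzOnWith_arg hx
  rw [← nhdsWithin_univ] at hU
  refine hψ.comp_lipschitzOnWith hK hU (tendsto_nhdsWithin_iff.2 ⟨?_, ?_⟩)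
  · exact (Complex.continuousAt_arg hx).continuousWithinAt
  · exact .of_forall fun z => ⟨(Complex.neg_pi_lt_arg z).le, Complex.arg_le_pi z⟩

/-- The argument of `-z` in terms of the argument `t` of `z`. It is used to move the branch cut of
`arg` from the negative to the positive axis. -/
def oppositeAngle (t : ℝ) : ℝ := if t ≤ 0 then t + π else t - π

lemma arg_neg_eq_oppositeAngle {z : ℂ} (hz : z ≠ 0) : (-z).arg = oppositeAngle z.arg := by
  have hre : z.im = 0 → z.arg ≠ 0 → z.re < 0 := fun him harg =>
    not_le.1 fun h => harg (Complex.arg_eq_zero_iff.2 ⟨h, him⟩)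
  unfold oppositeAngle
  split_ifs with h
  · refine Complex.arg_neg_eq_arg_add_pi_iff.2 ?_
    rcases h.lt_or_eq with hneg | hzero
    · exact .inl (Complex.arg_neg_iff.1 hneg)
    · obtain ⟨hre0, him⟩ := Complex.arg_eq_zero_iff.1 hzero
      exact .inr ⟨him, hre0.lt_of_ne fun h0 => hz (Complex.ext h0.symm him)⟩
  · refine Complex.arg_neg_eq_arg_sub_pi_iff.2 ?_
    have hpos : 0 < z.arg := not_le.1 h
    rcases (Complex.arg_nonneg_iff.1 hpos.le).lt_or_eq with him | him
    · exact .inl him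
    · exact .inr ⟨him.symm, hre him.symm hpos.ne'⟩

lemma logHolderWithinAt_comp_oppositeAngle (hψπ : ψ (-π) = ψ π)
    (hl : LogHolderWithinAt ψ (Icc (-π) π) (-π)) (hr : LogHolderWithinAt ψ (Icc (-π) π) π) :
    LogHolderWithinAt (ψ ∘ oppositeAngle) univ 0 := by
  refine .of_Iic_of_Ici ?_ ?_
  · have hr' : LogHolderWithinAt ψ (Icc (-π) π) (0 + π) := by rwa [zero_add]
    have hT : ∀ᶠ t in 𝓝[≤] (0 : ℝ), t + π ∈ Icc (-π) π := by
      filter_upwards [Icc_mem_nhdsLE (neg_lt_zero.2 pi_pos)] with t ht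
      exact ⟨by linarith [ht.1, pi_pos], by linarith [ht.2]⟩
    refine (hr'.comp_lipschitzWith (f := (· + π)) (isometry_add_right π).lipschitz hT).congr ?_
    filter_upwards [self_mem_nhdsWithin] with t ht
    rw [Function.comp_apply, Function.comp_apply, oppositeAngle, if_pos (mem_Iic.1 ht)]
  · have hl' : LogHolderWithinAt ψ (Icc (-π) π) (0 + -π) := by rwa [zero_add]
    have hT : ∀ᶠ t in 𝓝[≥] (0 : ℝ), t + -π ∈ Icc (-π) π := by
      filter_upwards [Icc_mem_nhdsGE pi_pos] with t ht
      exact ⟨by linarith [ht.1], by linarith [ht.2, pi_pos]⟩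
    refine (hl'.comp_lipschitzWith (f := (· + -π)) (isometry_add_right (-π)).lipschitz hT).congr ?_
    filter_upwards [self_mem_nhdsWithin] with t ht
    rw [Function.comp_apply, Function.comp_apply, oppositeAngle]
    rcases (mem_Ici.1 ht).eq_or_lt with rfl | hpos
    · rw [if_pos le_rfl, zero_add, zero_add, hψπ]
    · rw [if_neg hpos.not_ge, sub_eq_add_neg]

lemma logHolderWithinAt_comp_arg (hψπ : ψ (-π) = ψ π)
    (hH : ∀ s ∈ Icc (-π) π, s ≠ 0 → LogHolderNearReal ψ s) {x : ℂ} (hx : x ≠ 0)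
    (harg : x.arg ≠ 0) : LogHolderWithinAt (ψ ∘ Complex.arg) univ x := by
  have hππ : -π ≤ π := by linarith [pi_pos]
  by_cases hxπ : x.arg = π
  · have hneg : (-x).arg = 0 := by
      rw [arg_neg_eq_oppositeAngle hx, hxπ, oppositeAngle, if_neg pi_pos.not_ge, sub_self]
    have hslit : -x ∈ Complex.slitPlane :=
      Complex.mem_slitPlane_iff_arg.2 ⟨by rw [hneg]; exact pi_ne_zero.symm, neg_ne_zero.2 hx⟩
    have hopp : LogHolderWithinAt (ψ ∘ oppositeAngle) univ 0 :=
      logHolderWithinAt_comp_oppositeAngle hψπ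
        (hH _ (left_mem_Icc.2 hππ) (neg_ne_zero.2 pi_ne_zero)).logHolderWithinAt
        (hH _ (right_mem_Icc.2 hππ) pi_ne_zero).logHolderWithinAt
    rw [← hneg] at hopp
    refine (((hopp.mono (subset_univ _)).comp_arg hslit).comp_lipschitzWith
      isometry_neg.lipschitz (.of_forall fun _ => mem_univ _)).congr ?_
    rw [nhdsWithin_univ]
    filter_upwards [eventually_ne_nhds hx] with z hz
    simp only [Function.comp_apply, ← arg_neg_eq_oppositeAngle (neg_ne_zero.2 hz), neg_neg]
  · exact (hH _ ⟨(Complex.neg_pi_lt_arg x).le, Complex.arg_le_pi x⟩ harg).logHolderWithinAt.comp_arg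
      (Complex.mem_slitPlane_iff_arg.2 ⟨hxπ, hx⟩)

lemma logHolderNear_exponent (hψπ : ψ (-π) = ψ π)
    (hH : ∀ s ∈ Icc (-π) π, s ≠ 0 → LogHolderNearReal ψ s) (h0 : ξ.2 ≠ 0) (harg : ξ.2.arg ≠ 0) :
    LogHolderNear m₁ m₂ (exponent p₀ ψ) ξ := by
  have hsnd : LogHolderWithinAt (ψ ∘ Complex.arg ∘ Prod.snd) (bdry m₁ m₂) ξ :=
    (logHolderWithinAt_comp_arg hψπ hH h0 harg).comp_lipschitzWith LipschitzWith.prod_snd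
      (.of_forall fun _ => mem_univ _)
  exact (hsnd.const_add p₀).logHolderNear

end LogHolderExponent

lemma not_memLpVar_of_modular_eq_top {m₁ m₂ : ℝ} {p : ℂ × ℂ → ℝ} {g : ℂ × ℂ → ℂ}
    (h : ∀ t : ℝ, 0 < t → modular m₁ m₂ p (fun ξ => (t : ℂ) * g ξ) = ⊤) :
    ¬MemLpVar m₁ m₂ p g := fun ⟨_, t, ht, hlt⟩ => hlt.ne (h t ht)

end CLF
end

theorem theorem2_general {m₁ m₂ γ₁ γ₂ p₀ δ : ℝ} {ψ : ℝ → ℝ} (hm₁ : 1 ≤ m₁) (hm₂ : 1 ≤ m₂)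
    (hγ₁ : 0 < γ₁) (hγ : γ₁ < γ₂) (hγ₂ : 100 * m₁ * γ₂ ≤ 1) (hp₀ : 1 ≤ p₀)
    (hp : ∀ t ∈ Ioc (-π) π, 0 < p₀ + ψ t) (hψ0 : ψ 0 = 0) (hδ : 0 < δ)
    (hmono : MonotoneOn ψ (Icc 0 δ)) (hneg : ∀ t ∈ Ico (-δ) 0, ψ t ≤ 0)
    (hlim : Tendsto (fun t : ℝ => ψ t * log (1 / t)) (𝓝[>] 0) atTop) :
    (∃ α₀ : ℝ, 0 < α₀ ∧
      (∃ a : ℕ → ℝ, CLF.Admissible p₀ ψ α₀ a) ∧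
      ∀ a : ℕ → ℝ, CLF.Admissible p₀ ψ α₀ a →
        CLF.MemLpVar m₁ m₂ (CLF.exponent p₀ ψ) (CLF.testFun m₁ m₂ γ₁ γ₂ p₀ ψ a) ∧
        (∃ g : ℂ × ℂ → ℂ, CLF.IsImage m₁ m₂ (CLF.testFun m₁ m₂ γ₁ γ₂ p₀ ψ a) g) ∧
        ∀ g : ℂ × ℂ → ℂ, CLF.IsImage m₁ m₂ (CLF.testFun m₁ m₂ γ₁ γ₂ p₀ ψ a) g →
          (∀ t : ℝ, 0 < t →
            CLF.modular m₁ m₂ (CLF.exponent p₀ ψ) (fun ξ => (t : ℂ) * g ξ) = ⊤) ∧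
          ¬CLF.MemLpVar m₁ m₂ (CLF.exponent p₀ ψ) g) ∧
    ¬CLF.BoundedOnLpVar m₁ m₂ (CLF.exponent p₀ ψ) ∧
    (∀ ξ ∈ CLF.bdry m₁ m₂, ξ.2 ≠ 0 → Complex.arg ξ.2 = 0 →
      ¬CLF.LogHolderNear m₁ m₂ (CLF.exponent p₀ ψ) ξ) ∧
    (ψ (-π) = ψ π → (∀ s ∈ Icc (-π) π, s ≠ 0 → CLF.LogHolderNearReal ψ s) →
      ∀ ξ ∈ CLF.bdry m₁ m₂, ξ.2 ≠ 0 → Complex.arg ξ.2 ≠ 0 →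
        CLF.LogHolderNear m₁ m₂ (CLF.exponent p₀ ψ) ξ) := by
  obtain ⟨α₀, hα₀, hα₀le, hα₀δ⟩ : ∃ α₀ : ℝ, 0 < α₀ ∧ α₀ ≤ 1 / 200 ∧ 2 * α₀ ≤ δ :=
    ⟨min (1 / 200) (δ / 2), by positivity, min_le_left _ _,
      by linarith [min_le_right (1 / 200) (δ / 2)]⟩
  have hbdd : ∀ᶠ α in 𝓝[>] 0, ψ α ≤ ψ δ := by
    filter_upwards [Ioc_mem_nhdsGT hδ] with α hα
      using hmono ⟨hα.1.le, hα.2⟩ ⟨hδ.le, le_rfl⟩ hα.2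
  obtain ⟨b, hb⟩ := CLF.exists_admissible (p₀ := p₀) (by linarith) hbdd hlim hα₀
  have hmem {a} (ha : CLF.Admissible p₀ ψ α₀ a) :=
    ha.memLpVar_testFun (m₁ := m₁) (m₂ := m₂) (by linarith) (by linarith) hγ₁ hγ.le hp₀ hp
      (by linarith) (by nlinarith) hα₀δ hneg
  have himage {a} (ha : CLF.Admissible p₀ ψ α₀ a) :=
    CLF.exists_isImage_testFun hm₁ hm₂ ha.isHalving (hmem ha).1
  have htop {a} (ha : CLF.Admissible p₀ ψ α₀ a) {g}
      (hg : CLF.IsImage m₁ m₂ (CLF.testFun m₁ m₂ γ₁ γ₂ p₀ ψ a) g) (t : ℝ) (ht : 0 < t) :=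
    CLF.modular_image_testFun_eq_top hm₁ hm₂ hγ₁ hγ hγ₂ ha.isHalving
      (fun k => by linarith [ha.lt k]) (fun k => by linarith [ha.lt k]) hmono
      (fun k => hp _ ⟨by linarith [ha.pos k, pi_pos], by linarith [ha.lt k, pi_gt_three]⟩)
      (hmem ha).1 hg ht
  refine ⟨⟨α₀, hα₀, ⟨b, hb⟩, fun a ha => ⟨hmem ha, himage ha, fun g hg =>
    ⟨htop ha hg, CLF.not_memLpVar_of_modular_eq_top (htop ha hg)⟩⟩⟩, ?_,
    fun ξ hξ h0 harg => CLF.not_logHolderNear (by linarith) hψ0 hlim hξ h0 harg,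
    fun hψπ hH ξ _ h0 harg => CLF.logHolderNear_exponent hψπ hH h0 harg⟩
  rintro ⟨C, hC⟩
  obtain ⟨g, hg⟩ := himage hb
  exact CLF.not_memLpVar_of_modular_eq_top (htop hb hg) (hC _ g (hmem hb) hg).1

theorem theorem2 (m₁ m₂ : ℝ) (hm₁ : 1 ≤ m₁) (hm₂ : 1 ≤ m₂) :
    ∃ γ₁ γ₂ : ℝ, 0 < γ₁ ∧ γ₁ < γ₂ ∧
      ∀ (p₀ : ℝ) (ψ : ℝ → ℝ), CLF.Profile p₀ ψ →
        (∃ α₀ : ℝ, 0 < α₀ ∧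
          (∃ a : ℕ → ℝ, CLF.Admissible p₀ ψ α₀ a) ∧
          ∀ a : ℕ → ℝ, CLF.Admissible p₀ ψ α₀ a →
            CLF.MemLpVar m₁ m₂ (CLF.exponent p₀ ψ) (CLF.testFun m₁ m₂ γ₁ γ₂ p₀ ψ a) ∧
            (∃ g : ℂ × ℂ → ℂ, CLF.IsImage m₁ m₂ (CLF.testFun m₁ m₂ γ₁ γ₂ p₀ ψ a) g) ∧
            ∀ g : ℂ × ℂ → ℂ, CLF.IsImage m₁ m₂ (CLF.testFun m₁ m₂ γ₁ γ₂ p₀ ψ a) g →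
              (∀ t : ℝ, 0 < t →
                CLF.modular m₁ m₂ (CLF.exponent p₀ ψ) (fun ξ => (t : ℂ) * g ξ) = ⊤) ∧
              ¬ CLF.MemLpVar m₁ m₂ (CLF.exponent p₀ ψ) g) ∧
        ¬ CLF.BoundedOnLpVar m₁ m₂ (CLF.exponent p₀ ψ) ∧
        (∀ ξ ∈ CLF.bdry m₁ m₂, ξ.2 ≠ 0 → Complex.arg ξ.2 = 0 →
          ¬ CLF.LogHolderNear m₁ m₂ (CLF.exponent p₀ ψ) ξ) ∧
        (ψ (-Real.pi) = ψ Real.pi →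
          (∀ s ∈ Set.Icc (-Real.pi) Real.pi, s ≠ 0 → CLF.LogHolderNearReal ψ s) →
          ∀ ξ ∈ CLF.bdry m₁ m₂, ξ.2 ≠ 0 → Complex.arg ξ.2 ≠ 0 →
            CLF.LogHolderNear m₁ m₂ (CLF.exponent p₀ ψ) ξ) := by
  refine ⟨1 / (200 * m₁), 1 / (100 * m₁), by positivity,
    one_div_lt_one_div_of_lt (by positivity) (by linarith), fun p₀ ψ hP => ?_⟩
  obtain ⟨δ, hδ, -, hmono, hneg⟩ := hP.near
  exact theorem2_general hm₁ hm₂ (by positivity)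
    (one_div_lt_one_div_of_lt (by positivity) (by linarith))
    (mul_one_div_cancel (by positivity)).le hP.one_lt.le
    (fun t ht => by linarith [hP.lower t (Ioc_subset_Icc_self ht)]) hP.zero hδ hmono
    (fun t ht => (hneg t ht).le) hP.lim
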